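/- Let $(K,v)$ be a valued field with value group $\Gamma=v(K^*)$, valuation ring $\mathcal O$ and residue field $k$, and let $\Gamma_{\mathbb Q}=\Gamma\otimes\mathbb Q$. Fix an extension $\bar v$ of $v$ to an algebraic closure $\overline K$; let $K^h\subset K^{\mathrm{sep}}$ be the fixed field of the decomposition group $\{\sigma\in\mathrm{Gal}(K^{\mathrm{sep}}/K)\mid \bar v\circ\sigma=\bar v\}$, and $v^h=\bar v|_{K^h}$. All valuations on $K[x]$ below extend $v$ and take values in $\Gamma_{\mathbb Q}\cup\{\infty\}$. Every such valuation $\mu$ has a unique common extension $\mu^h$ with $v^h$ to $K^h[x]$. The Gauss valuations are $v_0(\sum_i c_ix^i)=\min_i v(c_i)$ on $K[x]$ and $v_0^h(\sum_i c_ix^i)=\min_i v^h(c_i)$ on $K^h[x]$. *Notation.* For monic $\phi\in K[x]$ of positive degree write $\phi$-expansions as $f=\sum_n a_n\phi^n$ with $\deg a_n<\deg\phi$. $N_{\mu,\phi}(f)$ is the lower convex hull of the points $(n,\mu(a_n))$ with $a_n\neq0$ in $\mathbb Q\times\Gamma_{\mathbb Q}$; $S_\lambda(N)$ is the set of points $(n,\alpha)\in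 N$ with $\alpha+n\lambda$ minimal; $N$ is one-sided of slope $-\lambda$ if $N=S_\lambda(N)$ and its left and right end abscissas are $0$ and positive, respectively. $[\mu;\phi,\lambda]$ denotes the valuation $f\mapsto\min_n(\mu(a_n)+n\lambda)$. Let $k_\mu$ be the residue field of the valuation induced by $\mu$ on the fraction field of $K[x]/\mu^{-1}(\infty)$, and $\kappa(\mu)$ the relative algebraic closure of $k$ in $k_\mu$. For $f\ne0$ let $S=\{n\mid \mu(a_n\phi^n)=\mu(f)\}$, $\ell_0=\min S$, $\ell=\max S$; let $e$ be the least positive integer with $e\mu(\phi)\in\{\mu(a)\mid a\neq 0,\ \deg a<\deg\phi\}$, $\ell-\ell_0=de$, $\ell_j=\ell_0+je$, and let $U\in K[x]$ have value $e\mu(\phi)$ and an initial term which is a unit in the graded algebra of $\mu$. The residual polynomial is $R_{\mu,\phi}(f)=\sum_{j=0}^d\zeta_jy^j\in\kappa(\mu)[y]$, where $\zeta_j$ is the residue class of $a_{\ell_j}U^{j-d}/a_\ell$ if $\ell_j\in S$, and $\zeta_j=0$ otherwise (whether $R_{\mu,\phi}(f)$ is an $m$-th power of an irreducible polynomial does not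 depend on $U$). *Splitting pairs.* Let $g\in K[x]$ be monic and square-free with $\operatorname{char}(k)\nmid\deg g$. The irreducibility test starts with $(\mu,\phi,n)=(v,x,\deg g)$, where $v$ is identified with the valuation $v_0$ on $K[x]$. While $n>1$: if $N_{\mu,\phi}(g)$ is one-sided, of slope $-\lambda$ say, and $R_{\mu_\lambda,\phi}(g)=\psi^m$ with $\mu_\lambda=[\mu;\phi,\lambda]$ and $\psi\in\kappa(\mu_\lambda)[y]$ monic irreducible, then replace $(\mu,\phi,n)$ by $(\mu_\lambda,\sqrt[m]{g},m)$, where $\sqrt[m]{g}$ is the monic polynomial $Q$ of degree $\deg(g)/m$ such that the coefficient of $Q^{m-1}$ in the $Q$-expansion of $g$ is $0$; otherwise stop. A *splitting pair* of $g$ is the pair $(\mu,\phi)$ at the last call of the while loop, that is, the pair which is not replaced any more. **Lemma.** Let $g\in\mathcal O[x]$ be monic and square-free with $\operatorname{char}(k)\nmid\deg g$, and let $(\mu,\phi)$ be a splitting pair of $g$. Suppose that $N_{\mu,\phi}(g)$ has at least one side (this is automatic if $g$ is reducible over $K^h$), let $-\lambda$ be its right end-slope, that is, the largest slope of its sides,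 and let $\mu_\lambda=[\mu;\phi,\lambda]$. Then every $F\in K^h[x]$ satisfies $$v_0^h(F)\ \le\ \mu^h(F)\ \le\ \mu_\lambda^h(F)\ \le\ v_0^h(F)+\frac{\deg F}{\deg\phi}\,\lambda .$$ -/

import Mathlib

open Polynomial

namespace OMFactorization

noncomputable section

/-! ### Valued fields, henselization -/

section Base

variable {K Γ : Type*} [Field K] [AddCommGroup Γ] [LinearOrder Γ] [IsOrderedAddMonoid Γ]

/-- A `Γ`-valued valuation `v`, regarded with values in the divisible hull `Γ_ℚ` of `Γ`. -/
def hullVal (v : AddValuation K (WithTop Γ)) : AddValuation K (WithTop (DivisibleHull Γ)) :=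
  v.map (DivisibleHull.coeAddMonoidHom Γ).withTopMap rfl
    (DivisibleHull.coeOrderAddMonoidHom Γ).monotone'.withTop_map

end Base

section Henselization

variable {K L Q : Type*} [Field K] [Field L] [Algebra K L]
  [AddCommGroup Q] [LinearOrder Q] [IsOrderedAddMonoid Q]

/-- For a valuation `w` on an algebraic closure `L` of `K`, the decomposition group
`{σ ∈ Gal(K^sep/K) | w ∘ σ = w}`, where `K^sep` is the separable closure of `K` in `L`. -/
def decompositionGroup (K : Type*) [Field K] [Algebra K L] (w : AddValuation L (WithTop Q)) :
    Subgroup (separableClosure K L ≃ₐ[K] separableClosure K L) where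
  carrier := {σ | ∀ x : separableClosure K L, w (σ x : L) = w (x : L)}
  one_mem' := fun _ => rfl
  mul_mem' := fun {σ τ} hσ hτ x => (hσ (τ x)).trans (hτ x)
  inv_mem' := fun {σ} hσ x => by
    have h := hσ (σ⁻¹ x)
    have e : σ (σ⁻¹ x) = x := by rw [← AlgEquiv.mul_apply, mul_inv_cancel]; rfl
    rw [e] at h
    exact h.symm

/-- The henselization `K^h ⊆ K^sep` determined by `w`: the fixed field of the decomposition
group. -/
abbrev Henselization (K : Type*) [Field K] [Algebra K L] (w : AddValuation L (WithTop Q)) :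
    IntermediateField K (separableClosure K L) :=
  IntermediateField.fixedField (decompositionGroup K w)

/-- The valuation `v^h` on `K^h`, the restriction of `w`. -/
def henselVal (K : Type*) [Field K] [Algebra K L] (w : AddValuation L (WithTop Q)) :
    AddValuation (Henselization K w) (WithTop Q) :=
  w.comap ((algebraMap (separableClosure K L) L).comp
    (algebraMap (Henselization K w) (separableClosure K L)))

end Henselization

/-! ### Valuations on the polynomial ring -/

section PolyVal

variable {K Q : Type*} [Field K] [AddCommGroup Q] [LinearOrder Q] [IsOrderedAddMonoid Q]

/-- The `Q`-valued valuations on `K[x]` whose restriction to `K` is `v`. -/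
structure PolyVal (v : AddValuation K (WithTop Q)) where
  val : AddValuation K[X] (WithTop Q)
  val_C : ∀ a : K, val (C a) = v a

/-- The Gauss valuation `v₀(∑ cᵢ xⁱ) = min v(cᵢ)`. -/
def gauss (v : AddValuation K (WithTop Q)) (f : K[X]) : WithTop Q :=
  f.support.inf fun i => v (f.coeff i)

/-- The `n`-th coefficient `a_n` of the `φ`-expansion `f = ∑ a_n φ^n`, `deg a_n < deg φ`
(for `φ` monic of positive degree). -/
def expCoeff (φ f : K[X]) (n : ℕ) : K[X] :=
  (f /ₘ φ ^ n) %ₘ φ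

/-- `ν = [μ; φ, γ]`, that is, `ν(∑ a_n φ^n) = min (μ(a_n) + n γ)` on `φ`-expansions. For `φ = x`
and `μ` extending `v`, this is the depth-zero valuation `[v; x, γ]`. -/
def IsAugmentation {v : AddValuation K (WithTop Q)} (μ : PolyVal v) (φ : K[X]) (γ : Q)
    (ν : PolyVal v) : Prop :=
  ∀ f : K[X], ν.val f =
    (Finset.range (f.natDegree + 1)).inf fun n => μ.val (expCoeff φ f n) + ((n • γ : Q) : WithTop Q)

/-! ### Newton polygons -/

/-- The points `(n, μ(a_n))` with `a_n ≠ 0` the coefficients of the `φ`-expansion of `g`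
(more precisely, those with `μ(a_n) < ∞`). -/
def newtonCloud {v : AddValuation K (WithTop Q)} (μ : PolyVal v) (φ g : K[X]) : Set (ℚ × Q) :=
  {P | ∃ n : ℕ, P.1 = n ∧ μ.val (expCoeff φ g n) = (P.2 : WithTop Q)}

/-- The lower convex hull of a set of points: the lower border of its convex hull. -/
def lowerHull [Module ℚ Q] (c : Set (ℚ × Q)) : Set (ℚ × Q) :=
  {P | P ∈ convexHull ℚ c ∧ ∀ P' ∈ convexHull ℚ c, P'.1 = P.1 → P.2 ≤ P'.2}

/-- The Newton polygon `N_{μ,φ}(g)`. -/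
def newtonPolygon [Module ℚ Q] {v : AddValuation K (WithTop Q)} (μ : PolyVal v) (φ g : K[X]) :
    Set (ℚ × Q) :=
  lowerHull (newtonCloud μ φ g)

/-- The `lam`-component `S_λ(N)`: the points `(n, α)` of `N` with `α + n λ` minimal. -/
def component [Module ℚ Q] (N : Set (ℚ × Q)) (lam : Q) : Set (ℚ × Q) :=
  {P | P ∈ N ∧ ∀ P' ∈ N, P.2 + P.1 • lam ≤ P'.2 + P'.1 • lam}

/-- `N` is one-sided of slope `-λ`: `N = S_λ(N)`, with left end abscissa `0` and positive right
end abscissa. -/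
def IsOneSided [Module ℚ Q] (N : Set (ℚ × Q)) (lam : Q) : Prop :=
  N = component N lam ∧ IsLeast (Prod.fst '' component N lam) 0 ∧ ∃ P ∈ component N lam, 0 < P.1

/-- `N` has a side of slope `-λ`. -/
def HasSide [Module ℚ Q] (N : Set (ℚ × Q)) (lam : Q) : Prop :=
  ∃ P ∈ component N lam, ∃ P' ∈ component N lam, P.1 < P'.1

/-- `-λ` is the right end-slope of `N`: it is the slope of a side, and all slopes `-ε` of `N`
satisfy `-ε ≤ -λ`. -/
def IsRightEndSlope [Module ℚ Q] (N : Set (ℚ × Q)) (lam : Q) : Prop :=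
  HasSide N lam ∧ ∀ ε : Q, HasSide N ε → lam ≤ ε

/-! ### Residue fields -/

/-- The valuation ring `𝒪` of `v`. -/
abbrev valRing (v : AddValuation K (WithTop Q)) : ValuationSubring K :=
  (AddValuation.toValuation v).valuationSubring

/-- The residue field `k` of `v`. -/
abbrev baseResidueField (v : AddValuation K (WithTop Q)) : Type _ :=
  IsLocalRing.ResidueField (valRing v)

namespace PolyVal

variable {v : AddValuation K (WithTop Q)}

/-- The support of `μ`, i.e. `μ⁻¹(∞)`. -/
abbrev support (μ : PolyVal v) : Ideal K[X] := (AddValuation.toValuation μ.val).supp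

/-- The field of fractions of `K[x]/supp(μ)`. -/
abbrev FracField (μ : PolyVal v) : Type _ := FractionRing (K[X] ⧸ μ.support)

theorem nonZeroDivisors_le (μ : PolyVal v) :
    nonZeroDivisors (K[X] ⧸ μ.support) ≤
      ((AddValuation.toValuation μ.val).onQuot le_rfl).supp.primeCompl := by
  intro x hx h
  rw [SetLike.mem_coe, Valuation.supp_quot_supp] at h
  exact nonZeroDivisors.ne_zero hx h

/-- The valuation induced by `μ` on the field of fractions of `K[x]/supp(μ)`
(in multiplicative notation). -/
def fracVal (μ : PolyVal v) : Valuation μ.FracField (Multiplicative (WithTop Q)ᵒᵈ) :=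
  ((AddValuation.toValuation μ.val).onQuot le_rfl).extendToLocalization
    μ.nonZeroDivisors_le μ.FracField

/-- The valuation ring of the valuation induced by `μ`. -/
abbrev fracRing (μ : PolyVal v) : ValuationSubring μ.FracField := μ.fracVal.valuationSubring

/-- The residue field `k_μ`. -/
abbrev ResidueField (μ : PolyVal v) : Type _ := IsLocalRing.ResidueField μ.fracRing

/-- The canonical map `K[x] → Frac(K[x]/supp(μ))`. -/
def toFrac (μ : PolyVal v) : K[X] →+* μ.FracField :=
  (algebraMap (K[X] ⧸ μ.support) μ.FracField).comp (Ideal.Quotient.mk μ.support)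

theorem fracVal_toFrac (μ : PolyVal v) (f : K[X]) :
    μ.fracVal (μ.toFrac f) = AddValuation.toValuation μ.val f := by
  unfold fracVal toFrac
  rw [RingHom.comp_apply, Valuation.extendToLocalization_apply_map_apply]
  rfl

theorem fracVal_C (μ : PolyVal v) (a : K) :
    μ.fracVal (μ.toFrac (C a)) = AddValuation.toValuation v a :=
  (μ.fracVal_toFrac _).trans (congrArg (fun t => Multiplicative.ofAdd (OrderDual.toDual t))
    (μ.val_C a))

/-- The canonical map from the valuation ring of `v` to that of `μ`. -/
def baseMap (μ : PolyVal v) : valRing v →+* μ.fracRing :=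
  ((μ.toFrac.comp C).comp (valRing v).subtype).codRestrict μ.fracRing.toSubring fun a => by
    change μ.fracVal (μ.toFrac (C (a : K))) ≤ 1
    rw [fracVal_C]
    exact a.2

instance isLocalHom_baseMap (μ : PolyVal v) : IsLocalHom μ.baseMap where
  map_nonunit a ha := by
    have h1 := (Valuation.valuationSubring.integers μ.fracVal).isUnit_iff_valuation_eq_one.mp ha
    have h2 : AddValuation.toValuation v (a : K) = 1 := (μ.fracVal_C (a : K)).symm.trans h1
    exact (Valuation.valuationSubring.integers
      (AddValuation.toValuation v)).isUnit_iff_valuation_eq_one.mpr h2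

/-- The canonical embedding `k → k_μ`. -/
instance algebraResidue (μ : PolyVal v) : Algebra (baseResidueField v) μ.ResidueField :=
  (IsLocalRing.ResidueField.map μ.baseMap).toAlgebra

/-- `κ(μ)`, the relative algebraic closure of `k` in `k_μ`. -/
abbrev kappa (μ : PolyVal v) : IntermediateField (baseResidueField v) μ.ResidueField :=
  algebraicClosure (baseResidueField v) μ.ResidueField

open Classical in
/-- The residue class in `k_μ` of an element of value `≥ 0` (and `0` on all other elements). -/
def residue (μ : PolyVal v) (z : μ.FracField) : μ.ResidueField :=
  if h : z ∈ μ.fracRing then IsLocalRing.residue μ.fracRing ⟨z, h⟩ else 0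

/-! ### Residual polynomials -/

/-- `in_μ U` is a unit of the graded algebra `𝒢_μ`: there is `V` with
`in_μ U * in_μ V = in_μ 1`, that is, `μ(U V - 1) > 0`. -/
def IsUnitInitial (μ : PolyVal v) (U : K[X]) : Prop :=
  ∃ V : K[X], 0 < μ.val (U * V - 1)

/-- `e = e_rel(μ)`, the least positive integer such that `e μ(φ) ∈ Γ_μ⁰`, where `Γ_μ⁰` is the set
of all `μ(a)` with `a ≠ 0`, `deg a < deg φ` (for `φ` a key polynomial of minimal degree). -/
def eRel (μ : PolyVal v) (φ : K[X]) : ℕ :=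
  sInf {n | 0 < n ∧ ∃ a : K[X], a ≠ 0 ∧ a.degree < φ.degree ∧ μ.val a = n • μ.val φ}

open Classical in
/-- `S_{μ,φ}(g) = {n | μ(a_n φ^n) = μ(g)}`, as a finite set (for `g ≠ 0`). -/
def levelSet (μ : PolyVal v) (φ g : K[X]) : Finset ℕ :=
  (Finset.range (g.natDegree + 1)).filter fun n => μ.val (expCoeff φ g n * φ ^ n) = μ.val g

open Classical in
/-- The residual polynomial `R_{μ,φ,u}(g) = ∑ ζ_j y^j`, `0 ≤ j ≤ d`, where `u = in_μ U`,
`ℓ₀ = min S`, `ℓ = max S`, `ℓ - ℓ₀ = d e`, `ℓ_j = ℓ₀ + j e`, and `ζ_j` is the image in `k_μ` of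
`(in a_ℓ)⁻¹ u^(j-d) (in a_{ℓ_j})` if `ℓ_j ∈ S`, `ζ_j = 0` otherwise. -/
def residualPoly (μ : PolyVal v) (φ U g : K[X]) : μ.ResidueField[X] :=
  if h : (μ.levelSet φ g).Nonempty then
    let l₀ := (μ.levelSet φ g).min' h
    let l := (μ.levelSet φ g).max' h
    let e := μ.eRel φ
    let d := (l - l₀) / e
    ∑ j ∈ Finset.range (d + 1),
      if l₀ + j * e ∈ μ.levelSet φ g then
        monomial j (μ.residue (μ.toFrac (expCoeff φ g (l₀ + j * e)) /
          (μ.toFrac (expCoeff φ g l) * μ.toFrac U ^ (d - j))))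
      else 0
  else 0

/-- `R_{μ,φ}(g) = ψ^m` for some monic irreducible `ψ ∈ κ(μ)[y]`, where `R_{μ,φ} = R_{μ,φ,u}` for
a homogeneous unit `u` of grade `e μ(φ)`. -/
def ResidualIsPower (μ : PolyVal v) (φ g : K[X]) (m : ℕ) : Prop :=
  ∃ U : K[X], μ.IsUnitInitial U ∧ μ.val U = μ.eRel φ • μ.val φ ∧
    ∃ ψ : μ.kappa[X], ψ.Monic ∧ Irreducible ψ ∧
      μ.residualPoly φ U g = (ψ ^ m).map (algebraMap μ.kappa μ.ResidueField)

end PolyVal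

/-! ### The irreducibility test and splitting pairs -/

/-- `q` is the `m`-th approximate root of `g`: it is monic of degree `deg(g)/m`, and the
coefficient of `q^(m-1)` in the `q`-expansion of `g` vanishes. -/
def IsApproxRoot (m : ℕ) (g q : K[X]) : Prop :=
  0 < m ∧ q.Monic ∧ m * q.natDegree = g.natDegree ∧ expCoeff q g (m - 1) = 0

/-- One passage through the body of the while loop of the irreducibility test, from the data
`(μ, φ, n)` to `(ν, q, m)`: `n > 1`, the polygon `N_{μ,φ}(g)` is one-sided of some slope `-λ`,
`ν = [μ; φ, λ]`, `R_{ν,φ}(g)` is the `m`-th power of an irreducible polynomial in `κ(ν)[y]`, and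
`q` is the `m`-th approximate root of `g`. -/
def TestStep [Module ℚ Q] {v : AddValuation K (WithTop Q)} (g : K[X])
    (s t : PolyVal v × K[X] × ℕ) : Prop :=
  1 < s.2.2 ∧ (∃ lam : Q, IsOneSided (newtonPolygon s.1 s.2.1 g) lam ∧
    IsAugmentation s.1 s.2.1 lam t.1) ∧
    t.1.ResidualIsPower s.2.1 g t.2.2 ∧ IsApproxRoot t.2.2 g t.2.1

/-- `(μ, φ)` is a splitting pair of `g`: it is the pair considered in the last call of the while
loop, that is, the test started at `(v, x, deg g)` reaches `(μ, φ, n)` for some `n`, and no further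
passage from there to another call is possible. In the initial pair `(v, x)`, the valuation `v` is
represented by its Gauss extension to `K[x]`. -/
def IsSplittingPair [Module ℚ Q] {v : AddValuation K (WithTop Q)} (g : K[X])
    (μ : PolyVal v) (φ : K[X]) : Prop :=
  ∃ (μ₀ : PolyVal v) (n : ℕ), (∀ f : K[X], μ₀.val f = gauss v f) ∧
    Relation.ReflTransGen (TestStep g) (μ₀, X, g.natDegree) (μ, φ, n) ∧
    ∀ t, ¬ TestStep g (μ, φ, n) t

end PolyVal

/-! ### Extension to the henselization -/

/-- `ν` is a common extension of `μ` and `v^h` to `K^h[x]`. -/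
def IsCommonExtension {K L Q : Type*} [Field K] [Field L] [Algebra K L]
    [AddCommGroup Q] [LinearOrder Q] [IsOrderedAddMonoid Q]
    {v : AddValuation K (WithTop Q)} (w : AddValuation L (WithTop Q)) (μ : PolyVal v)
    (ν : PolyVal (henselVal K w)) : Prop :=
  ∀ f : K[X], ν.val (f.map (algebraMap K (Henselization K w))) = μ.val f

end

end OMFactorization

open Polynomial

namespace OMFactorization

noncomputable section

set_option linter.unusedSectionVars false

/-! ### `φ`-expansions -/

section Expansion

variable {K : Type*} [Field K] {φ : K[X]}

/-! The extensions to `K^h[x]` are computed by the same iterated minimum formula as the valuations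
on `K[x]`, and all three inequalities are read off from that formula.

Immediacy (`exists_approx_henselization`). Every nonzero `c` in `K^h` satisfies `v^h(c - a) >
v^h(c)` for some `a` in `K`. By compactness of the Galois group, `c` lies in a finite Galois
extension in which the stabilizer of the valuation already fixes it. Take a unit `η` fixed by the
stabilizer whose images under all other automorphisms have positive value. For suitable `N`, the
value of `c η^N` differs from those of its other conjugates. It is then an isolated root of its
minimal polynomial, so a quotient of consecutive coefficients approximates it. The same holds for
`η^N`, hence for `c`.

Lifting (`IsLift`). The valuations of the test arise from the Gauss valuation by augmentations `min
(μ(a_n) + n λ)`. The same formula over `K^h` defines a function `β` lying below every extension of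
every valuation `≥ μ`. Approximating coefficients forces `μ^h = β` (`IsLift.eq_val`). As `μ ≤ μ_λ`
on `K[x]`, this gives `μ^h ≤ μ_λ^h`; for the Gauss valuation it gives `v_0^h ≤ μ^h`. The upper bound
is carried along the augmentations: `φ` is integral, so some coefficient `a_n` of the expansion of
`F` has Gauss value at most that of `F`. The term `a_n φ^n` exceeds this by at most `(deg a_n + n
deg φ) λ / deg φ`, provided `λ / deg φ` never decreases along the test.

The test (`TestInvariant.step`). The degree of the residual polynomial gives `n = m e d`, so the
approximate root `q` has degree `e d deg φ`. Since `m` is a unit, a Newton-type iteration from `φ^(e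
d)` shows that `ν(q) = e d λ`, the largest value possible for that degree
(`IsMinimal.le_val_approxRoot`). Hence `q` is again minimal (`IsMinimal.of_monic`), and a side of
slope `-λ'` in the next polygon has `λ' ≥ ν(q)` (`HasExpansion.le_of_hasSide`). The same iteration
for the Gauss valuation and `x` shows that `q` is integral. -/

theorem divByMonic_pow_succ (hφ : φ.Monic) (f : K[X]) (n : ℕ) :
    f /ₘ φ ^ (n + 1) = (f /ₘ φ) /ₘ φ ^ n := by
  refine (div_modByMonic_unique ((f /ₘ φ) /ₘ φ ^ n) (φ * ((f /ₘ φ) %ₘ φ ^ n) + f %ₘ φ)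
    (hφ.pow _) ⟨?_, ?_⟩).1
  · have h1 := modByMonic_add_div f φ
    have h2 := modByMonic_add_div (f /ₘ φ) (φ ^ n)
    linear_combination φ * h2 + h1
  · have hd : degree (f %ₘ φ) < degree φ := degree_modByMonic_lt _ hφ
    have hd' : degree ((f /ₘ φ) %ₘ φ ^ n) < degree (φ ^ n) := degree_modByMonic_lt _ (hφ.pow n)
    refine (degree_add_le _ _).trans_lt (max_lt ?_ (hd.trans_le ?_))
    · rw [pow_succ', degree_mul, degree_mul]
      exact WithBot.add_lt_add_left (by simp [degree_eq_bot, hφ.ne_zero]) hd'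
    · rw [pow_succ', degree_mul, degree_eq_natDegree hφ.ne_zero,
        degree_eq_natDegree (hφ.pow n).ne_zero]
      norm_cast
      omega

theorem expCoeff_zero_right (φ f : K[X]) : expCoeff φ f 0 = f %ₘ φ := by
  simp [expCoeff]

theorem expCoeff_succ (hφ : φ.Monic) (f : K[X]) (n : ℕ) :
    expCoeff φ f (n + 1) = expCoeff φ (f /ₘ φ) n := by
  rw [expCoeff, divByMonic_pow_succ hφ, expCoeff]

theorem degree_expCoeff_lt (hφ : φ.Monic) (f : K[X]) (n : ℕ) :
    (expCoeff φ f n).degree < φ.degree :=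
  degree_modByMonic_lt _ hφ

theorem expCoeff_zero_left (φ : K[X]) (n : ℕ) : expCoeff φ 0 n = 0 := by
  simp [expCoeff]

theorem expCoeff_eq_zero (hφ : φ.Monic) {f : K[X]} {n : ℕ}
    (h : f.natDegree < n * φ.natDegree) : expCoeff φ f n = 0 := by
  have : f /ₘ φ ^ n = 0 := by
    rw [divByMonic_eq_zero_iff (hφ.pow n)]
    apply degree_lt_degree
    rwa [hφ.natDegree_pow]
  rw [expCoeff, this, zero_modByMonic]

theorem natDegree_expCoeff_add_le (hφ : φ.Monic) {f : K[X]} {n : ℕ} (h : expCoeff φ f n ≠ 0) :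
    (expCoeff φ f n).natDegree + n * φ.natDegree ≤ f.natDegree := by
  have h1 : n * φ.natDegree ≤ f.natDegree := by
    by_contra hlt
    exact h (expCoeff_eq_zero hφ (not_le.mp hlt))
  have h2 : (expCoeff φ f n).natDegree ≤ (f /ₘ φ ^ n).natDegree :=
    natDegree_le_natDegree (degree_modByMonic_le_left)
  rw [natDegree_divByMonic _ (hφ.pow n), hφ.natDegree_pow] at h2
  omega

theorem expCoeff_of_degree_lt (hφ : φ.Monic) {f : K[X]} (h : f.degree < φ.degree) :
    expCoeff φ f 0 = f := by
  rw [expCoeff_zero_right, (modByMonic_eq_self_iff hφ).mpr h]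

theorem add_divByMonic' (hφ : φ.Monic) (f g : K[X]) : (f + g) /ₘ φ = f /ₘ φ + g /ₘ φ := by
  refine (div_modByMonic_unique (f /ₘ φ + g /ₘ φ) (f %ₘ φ + g %ₘ φ) hφ ⟨?_, ?_⟩).1
  · linear_combination modByMonic_add_div f φ + modByMonic_add_div g φ
  · exact (degree_add_le _ _).trans_lt (max_lt (degree_modByMonic_lt _ hφ)
      (degree_modByMonic_lt _ hφ))

theorem expCoeff_add (hφ : φ.Monic) (f g : K[X]) (n : ℕ) :
    expCoeff φ (f + g) n = expCoeff φ f n + expCoeff φ g n := by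
  rw [expCoeff, add_divByMonic' (hφ.pow n), add_modByMonic, expCoeff, expCoeff]

theorem expCoeff_sub (hφ : φ.Monic) (f g : K[X]) (n : ℕ) :
    expCoeff φ (f - g) n = expCoeff φ f n - expCoeff φ g n := by
  rw [eq_sub_iff_add_eq, ← expCoeff_add hφ, sub_add_cancel]

theorem expCoeff_map {K' : Type*} [Field K'] (i : K →+* K') (hφ : φ.Monic) (f : K[X]) (n : ℕ) :
    expCoeff (φ.map i) (f.map i) n = (expCoeff φ f n).map i := by
  rw [expCoeff, expCoeff, map_modByMonic _ hφ, map_divByMonic _ (hφ.pow n), Polynomial.map_pow]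

theorem sum_expCoeff (hφ : φ.Monic) (hd : 0 < φ.natDegree) {N : ℕ} {f : K[X]}
    (h : f.degree < (N : ℕ)) : ∑ n ∈ Finset.range N, expCoeff φ f n * φ ^ n = f := by
  induction N generalizing f with
  | zero =>
    have : f = 0 := by simpa [Nat.WithBot.lt_zero_iff] using h
    simp [this]
  | succ N ih =>
    rw [Finset.sum_range_succ', expCoeff_zero_right]
    have h2 : (f /ₘ φ).degree < (N : ℕ) := by
      by_cases h0 : f /ₘ φ = 0
      · rw [h0, degree_zero]; exact WithBot.bot_lt_coe _
      have hf : f ≠ 0 := by rintro rfl; simp at h0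
      rw [degree_eq_natDegree h0, natDegree_divByMonic _ hφ]
      rw [degree_eq_natDegree hf] at h
      norm_cast at *
      have : ¬ f.natDegree < φ.natDegree := fun hlt =>
        h0 ((divByMonic_eq_zero_iff hφ).mpr (degree_lt_degree hlt))
      omega
    have h3 := ih h2
    conv_rhs => rw [← modByMonic_add_div f φ, ← h3]
    rw [Finset.mul_sum, pow_zero, mul_one, add_comm]
    congr 1
    refine Finset.sum_congr rfl fun n _ => ?_
    rw [expCoeff_succ hφ]
    ring

/-- Uniqueness of `φ`-expansions. It allows a polynomial to be built with prescribed expansion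
coefficients, as the approximants in `IsLift.augmentation` are. -/
theorem expCoeff_sum (hφ : φ.Monic) {N : ℕ} {a : ℕ → K[X]} (ha : ∀ n, (a n).degree < φ.degree)
    (m : ℕ) : expCoeff φ (∑ n ∈ Finset.range N, a n * φ ^ n) m = if m < N then a m else 0 := by
  induction N generalizing a m with
  | zero => simp [expCoeff_zero_left]
  | succ N ih =>
    have h := div_modByMonic_unique (f := ∑ n ∈ Finset.range (N + 1), a n * φ ^ n)
      (∑ n ∈ Finset.range N, a (n + 1) * φ ^ n) (a 0) hφ ⟨by
        rw [Finset.sum_range_succ', Finset.mul_sum, pow_zero, mul_one, add_comm]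
        congr 1
        exact Finset.sum_congr rfl fun n _ => by ring, ha 0⟩
    cases m with
    | zero => simp [expCoeff_zero_right, h.2]
    | succ m =>
      rw [expCoeff_succ hφ, h.1, ih fun n => ha (n + 1)]
      simp

theorem expCoeff_mul_pow (hφ : φ.Monic) {a : K[X]} (ha : a.degree < φ.degree) (n m : ℕ) :
    expCoeff φ (a * φ ^ n) m = if m = n then a else 0 := by
  have h := expCoeff_sum (N := n + 1) hφ (a := fun k => if k = n then a else 0) (fun k => by
    split_ifs
    · exact ha
    · simp [bot_lt_iff_ne_bot, hφ.ne_zero]) m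
  have e : ∑ k ∈ Finset.range (n + 1), (if k = n then a else 0) * φ ^ k = a * φ ^ n := by
    simp [ite_mul, Finset.sum_ite_eq']
  rw [e] at h
  rw [h]
  split_ifs <;> first | rfl | omega

end Expansion

/-! ### The function `f ↦ min (β(a_n) + n γ)` -/

section AugFun

variable {K Q : Type*} [Field K] [AddCommGroup Q] [LinearOrder Q]

/-- The function `∑ a_n φ^n ↦ min (β(a_n) + n γ)` on `φ`-expansions. -/
def augFun (β : K[X] → WithTop Q) (φ : K[X]) (γ : Q) (f : K[X]) : WithTop Q :=
  (Finset.range (f.natDegree + 1)).inf fun n => β (expCoeff φ f n) + ((n • γ : Q) : WithTop Q)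

variable {β : K[X] → WithTop Q} {φ : K[X]} {γ : Q}

theorem le_augFun {f : K[X]} {x : WithTop Q}
    (h : ∀ n, x ≤ β (expCoeff φ f n) + ((n • γ : Q) : WithTop Q)) : x ≤ augFun β φ γ f :=
  Finset.le_inf fun n _ => h n

theorem exists_augFun_eq (f : K[X]) :
    ∃ n, augFun β φ γ f = β (expCoeff φ f n) + ((n • γ : Q) : WithTop Q) := by
  obtain ⟨n, -, h⟩ := Finset.exists_mem_eq_inf (Finset.range (f.natDegree + 1)) ⟨0, by simp⟩
    (fun n => β (expCoeff φ f n) + ((n • γ : Q) : WithTop Q))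
  exact ⟨n, h⟩

variable [IsOrderedAddMonoid Q]

theorem augFun_le (hφ : φ.Monic) (hd : 0 < φ.natDegree) (h0 : β 0 = ⊤) (f : K[X]) (n : ℕ) :
    augFun β φ γ f ≤ β (expCoeff φ f n) + ((n • γ : Q) : WithTop Q) := by
  by_cases hn : n < f.natDegree + 1
  · exact Finset.inf_le (f := fun n => β (expCoeff φ f n) + ((n • γ : Q) : WithTop Q))
      (Finset.mem_range.mpr hn)
  · rw [expCoeff_eq_zero hφ, h0, top_add]
    · exact le_top
    · nlinarith

theorem augFun_of_degree_lt (hφ : φ.Monic) (hd : 0 < φ.natDegree) (h0 : β 0 = ⊤) {f : K[X]}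
    (h : f.degree < φ.degree) : augFun β φ γ f = β f := by
  apply le_antisymm
  · simpa [expCoeff_of_degree_lt hφ h] using augFun_le (γ := γ) hφ hd h0 f 0
  · refine le_augFun fun n => ?_
    rcases n with _ | n
    · simp [expCoeff_of_degree_lt hφ h]
    · rw [expCoeff_eq_zero hφ, h0, top_add]
      · exact le_top
      · by_cases hf : f = 0
        · rw [hf, natDegree_zero]
          positivity
        · have := natDegree_lt_natDegree hf h
          nlinarith

theorem augFun_self (hφ : φ.Monic) (hd : 0 < φ.natDegree) (h0 : β 0 = ⊤) (h1 : β 1 = 0) :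
    augFun β φ γ φ = (γ : WithTop Q) := by
  have hexp : ∀ n, expCoeff φ φ n = if n = 1 then 1 else 0 := fun n => by
    have := expCoeff_mul_pow hφ (a := 1) (by
      rw [degree_one]; exact natDegree_pos_iff_degree_pos.mp hd) 1 n
    simpa using this
  apply le_antisymm
  · simpa [hexp, h1] using augFun_le (γ := γ) hφ hd h0 φ 1
  · refine le_augFun fun n => ?_
    rw [hexp]
    split_ifs with hn
    · simp [hn, h1]
    · simp [h0]

end AugFun

/-! ### Immediacy of the henselization -/

section Immediate

variable {K M Q : Type*} [Field K] [Field M] [Algebra K M]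
  [AddCommGroup Q] [LinearOrder Q] [IsOrderedAddMonoid Q]

/-- A product of linear factors, none of whose roots has the value of `b`, has a strictly dominant
monomial at `b`. -/
theorem exists_dominant_coeff (w : AddValuation M (WithTop Q)) {b : M} (hb : b ≠ 0)
    (s : Multiset M) (hs : ∀ r ∈ s, w r ≠ w b) :
    ∃ i, w ((s.map fun r => X - C r).prod.coeff i * b ^ i) ≠ ⊤ ∧
      ∀ j, j ≠ i → w ((s.map fun r => X - C r).prod.coeff i * b ^ i) <
        w ((s.map fun r => X - C r).prod.coeff j * b ^ j) := by
  have hwb : w b ≠ ⊤ := w.ne_top_iff.mpr hb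
  induction s using Multiset.induction_on with
  | empty =>
    refine ⟨0, by simp, fun j hj => ?_⟩
    simp [coeff_one, hj]
  | cons r s ih =>
    obtain ⟨i, hi, hlt⟩ := ih fun x hx => hs x (Multiset.mem_cons_of_mem hx)
    set h := (s.map fun r => X - C r).prod
    have hr := hs r (Multiset.mem_cons_self r s)
    have hsucc : ∀ j, (((r ::ₘ s).map fun r => X - C r).prod.coeff (j + 1)) * b ^ (j + 1) =
        b * (h.coeff j * b ^ j) - r * (h.coeff (j + 1) * b ^ (j + 1)) := fun j => by
      rw [Multiset.map_cons, Multiset.prod_cons, sub_mul, coeff_sub, coeff_X_mul, coeff_C_mul]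
      ring
    have hzero : (((r ::ₘ s).map fun r => X - C r).prod.coeff 0) * b ^ 0 =
        - (r * (h.coeff 0 * b ^ 0)) := by
      rw [Multiset.map_cons, Multiset.prod_cons, sub_mul, coeff_sub, coeff_X_mul_zero,
        coeff_C_mul]
      ring
    have hle : ∀ j, w (h.coeff i * b ^ i) ≤ w (h.coeff j * b ^ j) := fun j => by
      rcases eq_or_ne j i with rfl | hj
      exacts [le_rfl, (hlt j hj).le]
    -- Multiplication by `X - r`: if `w r < w b`, the constant `-r` dominates at `b` and the
    -- dominant index stays; otherwise `X` dominates and the index moves up by one.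
    rcases lt_or_gt_of_ne hr with hr | hr
    · have hrt : w r ≠ ⊤ := hr.ne_top
      have key : ∀ j, w r + w (h.coeff i * b ^ i) < w b + w (h.coeff j * b ^ j) := fun j =>
        (WithTop.add_lt_add_right hi hr).trans_le (add_le_add_right (hle j) _)
      have hval : w ((((r ::ₘ s).map fun r => X - C r).prod.coeff i) * b ^ i) =
          w r + w (h.coeff i * b ^ i) := by
        cases i with
        | zero => rw [hzero, w.map_neg, w.map_mul]
        | succ i =>
          rw [hsucc, w.map_sub_eq_of_lt_right, w.map_mul]
          rw [w.map_mul r, w.map_mul b]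
          exact key i
      refine ⟨i, ?_, fun j hj => ?_⟩
      · rw [hval]; exact WithTop.add_ne_top.mpr ⟨hrt, hi⟩
      rw [hval]
      have h2 : w r + w (h.coeff i * b ^ i) < w r + w (h.coeff j * b ^ j) :=
        WithTop.add_lt_add_left hrt (hlt j hj)
      cases j with
      | zero => rwa [hzero, w.map_neg, w.map_mul r]
      | succ j =>
        rw [hsucc, sub_eq_add_neg]
        apply w.map_lt_add
        · rw [w.map_mul b]; exact key j
        · rwa [w.map_neg, w.map_mul r]
    · have key : ∀ j, w b + w (h.coeff i * b ^ i) < w r + w (h.coeff j * b ^ j) := fun j =>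
        (WithTop.add_lt_add_right hi hr).trans_le (add_le_add_right (hle j) _)
      have hval : w ((((r ::ₘ s).map fun r => X - C r).prod.coeff (i + 1)) * b ^ (i + 1)) =
          w b + w (h.coeff i * b ^ i) := by
        rw [hsucc, w.map_sub_eq_of_lt_left, w.map_mul]
        rw [w.map_mul r, w.map_mul b]
        exact key _
      refine ⟨i + 1, ?_, fun j hj => ?_⟩
      · rw [hval]; exact WithTop.add_ne_top.mpr ⟨hwb, hi⟩
      rw [hval]
      cases j with
      | zero => rw [hzero, w.map_neg, w.map_mul r]; exact key 0
      | succ j =>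
        rw [hsucc, sub_eq_add_neg]
        apply w.map_lt_add
        · rw [w.map_mul b]
          exact WithTop.add_lt_add_left hwb (hlt j fun h => hj (by rw [h]))
        · rw [w.map_neg, w.map_mul r]; exact key _

/-- A root of a polynomial over `K` which differs in value from all other roots is approximated
by an element of `K`. -/
theorem exists_approx_of_isolated (w : AddValuation M (WithTop Q)) {b : M} (hb : b ≠ 0)
    (s : Multiset M) (hs : ∀ r ∈ s, w r ≠ w b) (f : K[X])
    (hf : f.map (algebraMap K M) = (X - C b) * (s.map fun r => X - C r).prod) :
    ∃ a : K, w b < w (b - algebraMap K M a) := by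
  have hwb : w b ≠ ⊤ := w.ne_top_iff.mpr hb
  obtain ⟨i, hi, hlt⟩ := exists_dominant_coeff w hb s hs
  set h := (s.map fun r => X - C r).prod
  set ι := algebraMap K M
  have e1 : ι (f.coeff (i + 1)) = h.coeff i - b * h.coeff (i + 1) := by
    rw [← coeff_map, hf, sub_mul, coeff_sub, coeff_X_mul, coeff_C_mul]
  have hv1 : w (ι (f.coeff (i + 1)) * b ^ i) = w (h.coeff i * b ^ i) := by
    rw [e1, sub_mul, w.map_sub_eq_of_lt_left]
    have := hlt (i + 1) (by omega)
    rwa [show b * h.coeff (i + 1) * b ^ i = h.coeff (i + 1) * b ^ (i + 1) by ring]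
  have hne : ι (f.coeff (i + 1)) ≠ 0 := by
    intro h0
    rw [h0, zero_mul, w.map_zero] at hv1
    exact hi hv1.symm
  -- In `b f_{i+1} + f_i` the dominant contributions `b h_i` cancel, leaving only the neighbours
  -- `h_{i-1}` and `h_{i+1}`, which are strictly smaller terms at `b`.
  have hkey : w b + w (h.coeff i * b ^ i) <
      w ((b * ι (f.coeff (i + 1)) + ι (f.coeff i)) * b ^ i) := by
    have h1 : w b + w (h.coeff i * b ^ i) < w (-(b * (h.coeff (i + 1) * b ^ (i + 1)))) := by
      rw [w.map_neg, w.map_mul b]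
      exact WithTop.add_lt_add_left hwb (hlt _ (by omega))
    rcases i with _ | i
    · have e0 : ι (f.coeff 0) = - (b * h.coeff 0) := by
        rw [← coeff_map, hf, sub_mul, coeff_sub, coeff_X_mul_zero, coeff_C_mul, zero_sub]
      rw [e1, e0, show (b * (h.coeff 0 - b * h.coeff (0 + 1)) + -(b * h.coeff 0)) * b ^ 0 =
        -(b * (h.coeff (0 + 1) * b ^ (0 + 1))) by ring]
      exact h1
    · have e0 : ι (f.coeff (i + 1)) = h.coeff i - b * h.coeff (i + 1) := by
        rw [← coeff_map, hf, sub_mul, coeff_sub, coeff_X_mul, coeff_C_mul]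
      rw [e1, e0, show (b * (h.coeff (i + 1) - b * h.coeff (i + 1 + 1)) + (h.coeff i -
        b * h.coeff (i + 1))) * b ^ (i + 1) =
        b * (h.coeff i * b ^ i) + -(b * (h.coeff (i + 1 + 1) * b ^ (i + 1 + 1))) by ring]
      refine w.map_lt_add ?_ h1
      rw [w.map_mul b]
      exact WithTop.add_lt_add_left hwb (hlt _ (by omega))
  refine ⟨-(f.coeff i / f.coeff (i + 1)), ?_⟩
  have e2 : (b * ι (f.coeff (i + 1)) + ι (f.coeff i)) * b ^ i =
      (b - ι (-(f.coeff i / f.coeff (i + 1)))) * (ι (f.coeff (i + 1)) * b ^ i) := by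
    rw [map_neg, map_div₀]
    field_simp
    ring
  rw [e2, w.map_mul (b - _), hv1] at hkey
  exact lt_of_add_lt_add_right hkey

/-- Quotients of approximable elements are approximable. -/
theorem exists_approx_of_div (w : AddValuation M (WithTop Q)) {b c : M} (hb : b ≠ 0) (hc : c ≠ 0)
    (h1 : ∃ a : K, w b < w (b - algebraMap K M a)) (h2 : ∃ a : K, w c < w (c - algebraMap K M a)) :
    ∃ a : K, w (b / c) < w (b / c - algebraMap K M a) := by
  obtain ⟨a, ha⟩ := h1
  obtain ⟨a', ha'⟩ := h2
  set ι := algebraMap K M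
  have hwb : w b ≠ ⊤ := w.ne_top_iff.mpr hb
  have hwc : w c ≠ ⊤ := w.ne_top_iff.mpr hc
  have hva' : w (ι a') = w c := w.map_eq_of_lt_sub (by rwa [w.map_sub_swap])
  have ha0 : ι a' ≠ 0 := w.ne_top_iff.mp (hva' ▸ hwc)
  refine ⟨a / a', ?_⟩
  have key : w b + w c < w (b * (ι a' - c) + c * (b - ι a)) := by
    apply w.map_lt_add
    · rw [w.map_mul, w.map_sub_swap]
      exact WithTop.add_lt_add_left hwb ha'
    · rw [w.map_mul, add_comm]
      exact WithTop.add_lt_add_left hwc ha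
  have e : b * (ι a' - c) + c * (b - ι a) = (b / c - ι (a / a')) * (c * ι a') := by
    rw [map_div₀]
    field_simp
    ring
  have e' : w b + w c = w (b / c) + (w c + w c) := by
    rw [← add_assoc, ← w.map_mul (b / c), div_mul_cancel₀ b hc]
  rw [e, w.map_mul _ (c * ι a'), w.map_mul c, hva', e'] at key
  exact lt_of_add_lt_add_right key

end Immediate

/-! ### Geometric sums, separation of conjugate valuations, and approximation in finite Galois
extensions -/

section Immediate

variable {K M Q : Type*} [Field K] [Field M] [Algebra K M]
  [AddCommGroup Q] [LinearOrder Q] [IsOrderedAddMonoid Q]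

/-- The value of a product is the sum of the values. -/
theorem map_prod_eq_sum (w : AddValuation M (WithTop Q)) {ι : Type*} (s : Finset ι) (f : ι → M) :
    w (∏ i ∈ s, f i) = ∑ i ∈ s, w (f i) := by
  classical
  induction s using Finset.induction_on with
  | empty => simp
  | insert i s hi ih => rw [Finset.prod_insert hi, Finset.sum_insert hi, w.map_mul, ih]

/-- Comparing values in `(x - 1) (1 + ... + x^(n-1)) = x^n - 1` gives the value `(n - 1) w(x)`,
which is negative because `n ≥ 2`. -/
theorem val_geom_sum_of_neg (w : AddValuation M (WithTop Q)) {x : M} (hx : w x < 0) {n : ℕ}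
    (hn : 2 ≤ n) : w (∑ i ∈ Finset.range n, x ^ i) < 0 := by
  obtain ⟨γ, hγ⟩ := WithTop.ne_top_iff_exists.mp hx.ne_top
  have hγ0 : γ < 0 := by rwa [← hγ, ← WithTop.coe_zero, WithTop.coe_lt_coe] at hx
  have e := mul_geom_sum x n
  have h1 : w (x - 1) = w x := w.map_sub_eq_of_lt_left (by rwa [w.map_one])
  have h2 : w (x ^ n - 1) = w (x ^ n) := w.map_sub_eq_of_lt_left (by
    rw [w.map_one, w.map_pow, ← hγ]
    exact_mod_cast nsmul_neg hγ0 (by omega))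
  have h3 : w x + w (∑ i ∈ Finset.range n, x ^ i) = n • w x := by
    rw [← h1, ← w.map_mul, e, h2, w.map_pow, h1]
  have hne : w (∑ i ∈ Finset.range n, x ^ i) ≠ ⊤ := by
    intro h
    rw [h, ← hγ] at h3
    exact WithTop.coe_ne_top h3.symm
  obtain ⟨δ, hδ⟩ := WithTop.ne_top_iff_exists.mp hne
  rw [← hδ, ← hγ] at h3
  have h4 : γ + δ = n • γ := by exact_mod_cast h3
  rw [← hδ]
  obtain ⟨m, rfl⟩ : ∃ m, n = m + 1 := ⟨n - 1, by omega⟩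
  have h5 : δ = m • γ := by rw [succ_nsmul'] at h4; exact add_left_cancel h4
  rw [h5]
  exact_mod_cast nsmul_neg hγ0 (by omega)

theorem val_geom_sum_of_pos (w : AddValuation M (WithTop Q)) {x : M} (hx : 0 < w x) {n : ℕ}
    (hn : 0 < n) : w (∑ i ∈ Finset.range n, x ^ i) = 0 := by
  obtain ⟨n, rfl⟩ : ∃ m, n = m + 1 := ⟨n - 1, by omega⟩
  rw [Finset.sum_range_succ', pow_zero, w.map_add_eq_of_lt_right, w.map_one]
  rw [w.map_one]
  refine w.map_lt_sum' (WithTop.coe_lt_top 0) fun i _ => ?_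
  rw [pow_succ, w.map_mul, w.map_pow]
  exact lt_of_lt_of_le hx (le_add_of_nonneg_left (nsmul_nonneg hx.le _))

theorem val_geom_sum_nonneg (w : AddValuation M (WithTop Q)) {x : M} (hx : 0 ≤ w x) (n : ℕ) :
    0 ≤ w (∑ i ∈ Finset.range n, x ^ i) :=
  w.map_le_sum fun i _ => by rw [w.map_pow]; exact nsmul_nonneg hx _

/-- If a geometric sum of length `n` in a unit is not a unit, then those of length `n t + 1` are
units. -/
theorem val_geom_sum_of_mul_add_one (w : AddValuation M (WithTop Q)) {x : M} (hx : w x = 0) {n : ℕ}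
    (h : 0 < w (∑ i ∈ Finset.range n, x ^ i)) (t : ℕ) :
    w (∑ i ∈ Finset.range (n * t + 1), x ^ i) = 0 := by
  have h1 : ∀ t, 0 < w (∑ i ∈ Finset.range (n * t), x ^ i) := fun t => by
    induction t with
    | zero => simp
    | succ t ih =>
      rw [mul_add, mul_one, Finset.sum_range_add]
      refine w.map_lt_add ih ?_
      simp_rw [pow_add]
      rw [← Finset.mul_sum, w.map_mul, w.map_pow, hx, smul_zero, zero_add]
      exact h
  rw [Finset.sum_range_succ, w.map_add_eq_of_lt_right, w.map_pow, hx, smul_zero]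
  rw [w.map_pow, hx, smul_zero]
  exact h1 t

/-- Finitely many automorphisms: there is `n ≥ 2` such that the geometric sum of length `n` is a
unit at all those conjugates of `z` which are units. -/
theorem exists_geom_sum_unit {G : Type*} [Fintype G] (w : AddValuation M (WithTop Q)) (z : G → M) :
    ∃ n, 2 ≤ n ∧ ∀ σ, w (z σ) = 0 → w (∑ i ∈ Finset.range n, z σ ^ i) = 0 := by
  classical
  have hex : ∀ σ, ∃ n, 0 < n ∧ (w (z σ) = 0 →
      ∀ t, 0 < t → w (∑ i ∈ Finset.range (n * t + 1), z σ ^ i) = 0) := fun σ => by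
    -- If no geometric sum at `z σ` is a non-unit, every length is admissible and the modulus `1`
    -- serves.
    by_cases h : ∃ n, 0 < n ∧ 0 < w (∑ i ∈ Finset.range n, z σ ^ i)
    · obtain ⟨n, hn, hlt⟩ := h
      exact ⟨n, hn, fun hz t _ => val_geom_sum_of_mul_add_one w hz hlt t⟩
    · refine ⟨1, one_pos, fun hz t _ => ?_⟩
      push Not at h
      exact le_antisymm (h _ (by omega)) (val_geom_sum_nonneg w hz.ge _)
  choose n hn hz using hex
  have hprod : 0 < ∏ σ, n σ := Finset.prod_pos fun σ _ => hn σ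
  -- One more than a common multiple of all the moduli.
  refine ⟨∏ σ, n σ + 1, by omega, fun σ hσ => ?_⟩
  rw [← Finset.mul_prod_erase _ _ (Finset.mem_univ σ)]
  exact hz σ hσ _ (Finset.prod_pos fun σ _ => hn σ)

/-- The elements of a finite Galois group which preserve the values of all elements. -/
def valStabilizer (K : Type*) [Field K] [Algebra K M] (w : AddValuation M (WithTop Q)) :
    Subgroup (M ≃ₐ[K] M) where
  carrier := {σ | ∀ x, w (σ x) = w x}
  one_mem' := fun _ => rfl
  mul_mem' := fun {σ τ} hσ hτ x => (hσ (τ x)).trans (hτ x)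
  inv_mem' := fun {σ} hσ x => by
    have h := hσ (σ⁻¹ x)
    rw [← AlgEquiv.mul_apply, mul_inv_cancel, AlgEquiv.one_apply] at h
    exact h.symm

/-- The values of `w` are torsion over the values of the base field. -/
def TorsionOver (K : Type*) [Field K] [Algebra K M] (w : AddValuation M (WithTop Q)) : Prop :=
  ∀ z : M, z ≠ 0 → ∃ N : ℕ, 0 < N ∧ ∃ a : K, w (algebraMap K M a) = N • w z

variable [FiniteDimensional K M] (w : AddValuation M (WithTop Q))

/-- Start from `u` with `w(u) = 0` and `w(τ u) < 0`. The inverse of `1 + u + ... + u^(n-1)` has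
value `0` wherever `u` has positive value and positive value wherever `u` has negative value. The
choice of `n` makes it a unit where `u` is one. -/
theorem exists_unit_at_id_pos_at (htor : TorsionOver K w) {τ : M ≃ₐ[K] M} (hτ : τ ∉ valStabilizer K w) :
    ∃ y : M, w y = 0 ∧ 0 < w (τ y) ∧ ∀ σ : M ≃ₐ[K] M, 0 ≤ w (σ y) := by
  obtain ⟨z, hz0, hzlt⟩ : ∃ z, z ≠ 0 ∧ w (τ z) < w z := by
    obtain ⟨z, hz⟩ : ∃ z, w (τ z) ≠ w z := by
      by_contra! h
      exact hτ h
    have hz0 : z ≠ 0 := by rintro rfl; simp at hz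
    rcases lt_or_gt_of_ne hz with h | h
    · exact ⟨z, hz0, h⟩
    · refine ⟨z⁻¹, inv_ne_zero hz0, ?_⟩
      have h0 : w z⁻¹ + w z = 0 := by rw [← w.map_mul, inv_mul_cancel₀ hz0, w.map_one]
      have h1 : w (τ z⁻¹) + w (τ z) = 0 := by
        rw [← w.map_mul, ← map_mul, inv_mul_cancel₀ hz0, map_one, w.map_one]
      by_contra! hcon
      have hne : w z⁻¹ ≠ ⊤ := w.ne_top_iff.mpr (inv_ne_zero hz0)
      have := (WithTop.add_lt_add_left hne h).trans_le (add_le_add_left hcon (w (τ z)))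
      rw [h0, h1] at this
      exact this.false
  obtain ⟨N, hN, a, ha⟩ := htor z hz0
  have hzt : w z ≠ ⊤ := w.ne_top_iff.mpr hz0
  obtain ⟨γ, hγ⟩ := WithTop.ne_top_iff_exists.mp hzt
  obtain ⟨δ, hδ⟩ := WithTop.ne_top_iff_exists.mp hzlt.ne_top
  have ha0 : algebraMap K M a ≠ 0 := w.ne_top_iff.mp (by
    rw [ha, ← hγ]
    exact WithTop.coe_ne_top)
  have hδγ : δ < γ := by rw [← hγ, ← hδ] at hzlt; exact_mod_cast hzlt
  -- Dividing by an element of `K` shifts the values of all conjugates equally, so `u` has value `0`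
  -- while the strict inequality at `τ` persists.
  set u := z ^ N / algebraMap K M a
  have hu : w u = 0 := by
    have h1 : w u + N • w z = N • w z := by
      conv_lhs => rw [← ha]
      rw [← w.map_mul, div_mul_cancel₀ _ ha0, w.map_pow]
    rw [← hγ] at h1
    have hut : w u ≠ ⊤ := by
      intro h
      rw [h] at h1
      exact WithTop.coe_ne_top h1.symm
    obtain ⟨ε, hε⟩ := WithTop.ne_top_iff_exists.mp hut
    rw [← hε] at h1 ⊢
    have h2 : ε + N • γ = N • γ := by exact_mod_cast h1
    have : ε = 0 := by simpa using h2
    exact_mod_cast this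
  have hτu : w (τ u) < 0 := by
    have h1 : w (τ u) + N • w z = N • w (τ z) := by
      conv_lhs => rw [← ha]
      rw [← w.map_mul, ← τ.commutes a, ← map_mul, div_mul_cancel₀ _ ha0, map_pow, w.map_pow]
    rw [← hγ, ← hδ] at h1
    have hut : w (τ u) ≠ ⊤ := by
      intro h
      rw [h] at h1
      exact WithTop.coe_ne_top h1.symm
    obtain ⟨ε, hε⟩ := WithTop.ne_top_iff_exists.mp hut
    rw [← hε] at h1 ⊢
    have h2 : ε + N • γ = N • δ := by exact_mod_cast h1
    have h3 : N • δ < N • γ := nsmul_right_strictMono hN.ne' hδγ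
    have : ε < 0 := by
      rw [← h2] at h3
      exact lt_of_add_lt_add_right (h3.trans_eq (zero_add _).symm)
    exact_mod_cast this
  obtain ⟨n, hn, hunit⟩ := exists_geom_sum_unit w fun σ : M ≃ₐ[K] M => σ u
  have hmap : ∀ σ : M ≃ₐ[K] M, w (σ (∑ i ∈ Finset.range n, u ^ i)) =
      w (∑ i ∈ Finset.range n, σ u ^ i) := fun σ => by rw [map_sum]; simp_rw [map_pow]
  have hle : ∀ σ : M ≃ₐ[K] M, w (σ (∑ i ∈ Finset.range n, u ^ i)) ≤ 0 := fun σ => by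
    rw [hmap]
    rcases lt_trichotomy (w (σ u)) 0 with h | h | h
    · exact (val_geom_sum_of_neg w h hn).le
    · exact (hunit σ h).le
    · exact (val_geom_sum_of_pos w h (by omega)).le
  have hs0 : (∑ i ∈ Finset.range n, u ^ i) ≠ 0 := w.ne_top_iff.mp (by
    have := hle 1
    exact (this.trans_lt (WithTop.coe_lt_top 0)).ne)
  have hneg : ∀ σ : M ≃ₐ[K] M, w (σ (∑ i ∈ Finset.range n, u ^ i)⁻¹) +
      w (∑ i ∈ Finset.range n, σ u ^ i) = 0 := fun σ => by
    rw [← hmap, ← w.map_mul, ← map_mul, inv_mul_cancel₀ hs0, map_one, w.map_one]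
  refine ⟨(∑ i ∈ Finset.range n, u ^ i)⁻¹, ?_, ?_, fun σ => ?_⟩
  · have h1 := hneg 1
    rw [hunit 1 hu, add_zero] at h1
    exact h1
  · by_contra! hcon
    have h1 := hneg τ
    have h2 := val_geom_sum_of_neg w hτu hn
    exact h1.not_lt ((add_le_of_nonpos_left hcon).trans_lt h2)
  · by_contra! hcon
    have h1 := hneg σ
    have h2 := hle σ
    rw [hmap] at h2
    exact h1.not_lt ((add_le_of_nonpos_right h2).trans_lt hcon)

/-- An element fixed by the decomposition group, which is a unit for the given valuation, and which
has positive value for all other conjugate valuations. -/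
theorem exists_fixed_unit (htor : TorsionOver K w) : ∃ η : M, (∀ τ ∈ valStabilizer K w, τ η = η) ∧ w η = 0 ∧
    ∀ τ ∉ valStabilizer K w, 0 < w (τ η) := by
  classical
  have hex : ∀ τ : M ≃ₐ[K] M, ∃ y : M, w y = 0 ∧ (τ ∉ valStabilizer K w → 0 < w (τ y)) ∧
      ∀ σ : M ≃ₐ[K] M, 0 ≤ w (σ y) := fun τ => by
    by_cases hτ : τ ∈ valStabilizer K w
    · exact ⟨1, by simp, fun h => absurd hτ h, fun σ => by simp⟩
    · obtain ⟨y, h1, h2, h3⟩ := exists_unit_at_id_pos_at w htor hτ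
      exact ⟨y, h1, fun _ => h2, h3⟩
  choose y hy0 hypos hynn using hex
  set Y := ∏ τ, y τ
  have hY0 : w Y = 0 := by
    rw [map_prod_eq_sum]
    exact Finset.sum_eq_zero fun τ _ => hy0 τ
  have hYpos : ∀ τ ∉ valStabilizer K w, 0 < w (τ Y) := fun τ hτ => by
    rw [map_prod, map_prod_eq_sum, ← Finset.add_sum_erase _ _ (Finset.mem_univ τ)]
    exact add_pos_of_pos_of_nonneg (hypos τ hτ) (Finset.sum_nonneg fun σ _ => hynn σ τ)
  -- The norm over the stabilizer makes `Y` invariant. Its values behave as required because `τ δ`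
  -- stays outside the stabilizer when `τ` does.
  refine ⟨∏ δ : valStabilizer K w, (δ : M ≃ₐ[K] M) Y, fun τ hτ => ?_, ?_, fun τ hτ => ?_⟩
  · rw [map_prod]
    exact Fintype.prod_equiv (Equiv.mulLeft ⟨τ, hτ⟩) _ _ fun δ => rfl
  · rw [map_prod_eq_sum]
    exact Finset.sum_eq_zero fun δ _ => (δ.2 Y).trans hY0
  · rw [map_prod, map_prod_eq_sum]
    have hpos : ∀ δ : valStabilizer K w, 0 < w (τ ((δ : M ≃ₐ[K] M) Y)) := fun δ =>
      hYpos (τ * δ) fun h => hτ (by simpa using mul_mem h (inv_mem δ.2))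
    rw [← Finset.add_sum_erase _ _ (Finset.mem_univ 1)]
    exact add_pos_of_pos_of_nonneg (hpos 1) (Finset.sum_nonneg fun δ _ => (hpos δ).le)

/-- An element fixed by the decomposition group whose value differs from those of its other
conjugates is approximable. -/
theorem exists_approx_of_conj [IsGalois K M] {b : M} (hb : b ≠ 0)
    (hfix : ∀ τ ∈ valStabilizer K w, τ b = b)
    (hne : ∀ τ ∉ valStabilizer K w, w (τ b) ≠ w b) :
    ∃ a : K, w b < w (b - algebraMap K M a) := by
  classical
  have hint : IsIntegral K b := IsIntegral.of_finite K b
  have hsplit : ((minpoly K b).map (algebraMap K M)).Splits := Normal.splits inferInstance b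
  have hmonic : ((minpoly K b).map (algebraMap K M)).Monic := (minpoly.monic hint).map _
  have hroot : b ∈ ((minpoly K b).map (algebraMap K M)).roots := by
    rw [mem_roots hmonic.ne_zero, IsRoot, eval_map_algebraMap, minpoly.aeval]
  have hprod := hsplit.eq_prod_roots_of_monic hmonic
  refine exists_approx_of_isolated w hb (((minpoly K b).map (algebraMap K M)).roots.erase b) ?_
    (minpoly K b) ?_
  · intro r hr
    have hnd : ((minpoly K b).map (algebraMap K M)).roots.Nodup :=
      nodup_roots (Separable.map (Algebra.IsSeparable.isSeparable K b))
    rw [hnd.mem_erase_iff, mem_roots hmonic.ne_zero, IsRoot, eval_map_algebraMap] at hr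
    obtain ⟨τ, rfl⟩ := minpoly.exists_algEquiv_of_root' (Algebra.IsAlgebraic.isAlgebraic b) hr.2
    exact hne τ fun hτ => hr.1 (hfix τ hτ)
  · conv_lhs => rw [hprod, ← Multiset.cons_erase hroot, Multiset.map_cons, Multiset.prod_cons]

theorem exists_approx_of_fixed [IsGalois K M] (htor : TorsionOver K w)
    {c : M} (hc : c ≠ 0)
    (hfix : ∀ τ ∈ valStabilizer K w, τ c = c) :
    ∃ a : K, w c < w (c - algebraMap K M a) := by
  classical
  obtain ⟨η, hηfix, hη0, hηpos⟩ := exists_fixed_unit w htor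
  have hη : η ≠ 0 := w.ne_top_iff.mp (hη0 ▸ WithTop.coe_ne_top)
  -- As `w(τ η) > 0`, each `τ` excludes at most one exponent `N`, and there are finitely many `τ`.
  -- Positivity of `N` is what makes `η^N` isolated among its own conjugates.
  obtain ⟨N, hN, hNne⟩ : ∃ N : ℕ, 0 < N ∧ ∀ τ ∉ valStabilizer K w,
      w (τ c) + N • w (τ η) ≠ w c := by
    have hfin : Set.Finite (⋃ τ ∈ {τ | τ ∉ valStabilizer K w},
        {N : ℕ | w (τ c) + N • w (τ η) = w c}) := by
      refine Set.Finite.biUnion (Set.toFinite _) fun τ hτ => Set.Subsingleton.finite ?_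
      intro N hN N' hN'
      simp only [Set.mem_ofPred_eq] at hN hN'
      have hc1 : w (τ c) ≠ ⊤ := w.ne_top_iff.mpr (by simpa using hc)
      have hη1 : w (τ η) ≠ ⊤ := w.ne_top_iff.mpr (by simpa using hη)
      have hpos := hηpos τ hτ
      obtain ⟨γ, hγ⟩ := WithTop.ne_top_iff_exists.mp hc1
      obtain ⟨δ, hδ⟩ := WithTop.ne_top_iff_exists.mp hη1
      rw [← hN', ← hγ, ← hδ] at hN
      rw [← hδ] at hpos
      have hpos' : 0 < δ := by exact_mod_cast hpos
      have hN2 : γ + N • δ = γ + N' • δ := by exact_mod_cast hN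
      exact nsmul_left_strictMono hpos' |>.injective (add_left_cancel hN2)
    obtain ⟨N, hN⟩ := (hfin.union (Set.finite_singleton 0)).exists_notMem
    simp only [Set.mem_union, Set.mem_iUnion, not_or, Set.mem_ofPred_eq, Set.mem_singleton_iff,
      not_exists] at hN
    exact ⟨N, Nat.pos_of_ne_zero hN.2, fun τ hτ => hN.1 τ hτ⟩
  have hηN : η ^ N ≠ 0 := pow_ne_zero _ hη
  have h1 : ∃ a : K, w (c * η ^ N) < w (c * η ^ N - algebraMap K M a) := by
    refine exists_approx_of_conj w (mul_ne_zero hc hηN) (fun τ hτ => ?_) fun τ hτ => ?_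
    · rw [map_mul, map_pow, hfix τ hτ, hηfix τ hτ]
    · rw [map_mul, map_pow, w.map_mul, w.map_mul, w.map_pow, w.map_pow, hη0, smul_zero, add_zero]
      exact hNne τ hτ
  have h2 : ∃ a : K, w (η ^ N) < w (η ^ N - algebraMap K M a) := by
    refine exists_approx_of_conj w hηN (fun τ hτ => ?_) fun τ hτ => ?_
    · rw [map_pow, hηfix τ hτ]
    · rw [map_pow, w.map_pow, w.map_pow, hη0, smul_zero]
      obtain ⟨N, rfl⟩ : ∃ m, N = m + 1 := ⟨N - 1, by omega⟩
      rw [succ_nsmul]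
      exact ((hηpos τ hτ).trans_le (le_add_of_nonneg_left (nsmul_nonneg (hηpos τ hτ).le _))).ne'
  simpa [mul_div_assoc, div_self hηN] using exists_approx_of_div w (mul_ne_zero hc hηN) hηN h1 h2

end Immediate

/-! ### Passage from finite Galois extensions to the henselization -/

section Immediate

variable {K L Q : Type*} [Field K] [Field L] [Algebra K L]
  [AddCommGroup Q] [LinearOrder Q] [IsOrderedAddMonoid Q]

/-- The automorphisms which change the value of a given element form an open set. -/
theorem isOpen_setOf_val_ne (w : AddValuation L (WithTop Q)) (y : separableClosure K L) :
    IsOpen {σ : separableClosure K L ≃ₐ[K] separableClosure K L |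
      w (σ y : L) ≠ w (y : L)} := by
  rw [isOpen_iff_forall_mem_open]
  intro σ hσ
  refine ⟨(fun τ => σ⁻¹ * τ) ⁻¹'
    (MulAction.stabilizer (separableClosure K L ≃ₐ[K] separableClosure K L) y : Set _),
    fun τ hτ => ?_, (stabilizer_isOpen_of_isIntegral y).preimage (continuous_const_mul _), ?_⟩
  · have h : (σ⁻¹ * τ) • y = y := hτ
    rw [mul_smul, inv_smul_eq_iff] at h
    have h' : τ y = σ y := h
    simpa [h'] using hσ
  · simp

/-- The henselization is an immediate extension. -/
theorem exists_approx_henselization [IsAlgClosure K L] (w : AddValuation L (WithTop Q))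
    (htor : TorsionOver K w) {c : Henselization K w} (hc : c ≠ 0) :
    ∃ a : K, henselVal K w c < henselVal K w (c - algebraMap K _ a) := by
  classical
  have : IsAlgClosed L := IsAlgClosure.isAlgClosed K
  have : Normal K L := IsAlgClosure.normal K L
  set x : separableClosure K L := (c : separableClosure K L)
  have hcl : IsCompact {σ : separableClosure K L ≃ₐ[K] separableClosure K L | σ x ≠ x} :=
    IsClosed.isCompact
      (isOpen_compl_iff.mp (by
        convert stabilizer_isOpen_of_isIntegral (K := K) x using 1
        ext σ
        simp [MulAction.mem_stabilizer_iff]))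
  -- An automorphism moving `x` is not in the decomposition group, so it changes the value of some
  -- `y`. Finitely many such `y` detect all of them; adjoining these to `x` gives the finite level
  -- `M`.
  obtain ⟨t, ht⟩ := hcl.elim_finite_subcover _ (fun y => isOpen_setOf_val_ne w y) (by
    intro σ hσ
    by_contra hcon
    simp only [Set.mem_iUnion, Set.mem_ofPred_eq, not_exists, not_not] at hcon
    exact hσ (c.2 ⟨σ, hcon⟩))
  set M := FiniteGaloisIntermediateField.adjoin K (insert x (t : Set (separableClosure K L)))
  have hsub : insert x (t : Set (separableClosure K L)) ⊆ M.toIntermediateField :=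
    FiniteGaloisIntermediateField.subset_adjoin K _
  set wM : AddValuation M (WithTop Q) :=
    w.comap ((algebraMap (separableClosure K L) L).comp (algebraMap M (separableClosure K L)))
  have hwM : ∀ z : M, wM z = w ((z : separableClosure K L) : L) := fun _ => rfl
  have htorM : TorsionOver K wM := fun z hz => by
    obtain ⟨N, hN, a, ha⟩ := htor ((z : separableClosure K L) : L) (by simpa using hz)
    exact ⟨N, hN, a, ha⟩
  obtain ⟨a, ha⟩ := exists_approx_of_fixed wM htorM (c := ⟨x, hsub (Set.mem_insert _ _)⟩)
    (fun h => hc (by simpa [x] using congrArg Subtype.val h)) (fun τ hτ => by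
      -- A lift of `τ` moves `x`, hence changes the value of some `y` in `t`; but `y` lies in `M`,
      -- where `τ` preserves values.
      by_contra hne
      have hlift : ∀ z : M, (τ.liftNormal (separableClosure K L)) (z : separableClosure K L) =
        (τ z : M) := fun z => τ.liftNormal_commutes (separableClosure K L) z
      have hmem : τ.liftNormal (separableClosure K L) ∈
          {σ : separableClosure K L ≃ₐ[K] separableClosure K L | σ x ≠ x} := fun h =>
        hne (Subtype.ext ((hlift _).symm.trans h))
      obtain ⟨y, hy, hy'⟩ := Set.mem_iUnion₂.mp (ht hmem)
      refine hy' ?_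
      have h := hτ ⟨y, hsub (Set.mem_insert_of_mem _ hy)⟩
      rw [hwM, hwM] at h
      rw [← h, ← hlift])
  exact ⟨a, ha⟩

end Immediate

/-! ### Minimal polynomials of a valuation and approximate roots -/

section Minimal

variable {K Q : Type*} [Field K] [AddCommGroup Q] [LinearOrder Q] [IsOrderedAddMonoid Q]

/-- `φ` is `ν`-minimal: it is monic, and `ν(∑ a_n φ^n)` is the minimum of the values of the terms
of the `φ`-expansion. -/
structure IsMinimal (ν : AddValuation K[X] (WithTop Q)) (φ : K[X]) : Prop where
  monic : φ.Monic
  le_val_mod : ∀ f, ν f ≤ ν (f %ₘ φ)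

variable {ν : AddValuation K[X] (WithTop Q)} {φ q g : K[X]}

theorem IsMinimal.le_val_mul_div (h : IsMinimal ν φ) (f : K[X]) : ν f ≤ ν (φ * (f /ₘ φ)) := by
  have e : φ * (f /ₘ φ) = f - f %ₘ φ := eq_sub_of_add_eq' (modByMonic_add_div f φ)
  rw [e]
  exact ν.map_le_sub le_rfl (h.le_val_mod f)

theorem IsMinimal.le_val_expCoeff (h : IsMinimal ν φ) (f : K[X]) (n : ℕ) :
    ν f ≤ ν (expCoeff φ f n * φ ^ n) := by
  induction n generalizing f with
  | zero => simpa [expCoeff_zero_right] using h.le_val_mod f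
  | succ n ih =>
    rw [expCoeff_succ h.monic, pow_succ', mul_left_comm, ν.map_mul]
    exact (h.le_val_mul_div f).trans (by rw [ν.map_mul]; exact add_le_add_right (ih _) _)

theorem degree_lt_of_lt_of_lt_succ {f p : K[X]} {N : ℕ} (h : f.degree < p.degree)
    (hp : p.degree < (N + 1 : ℕ)) : f.degree < (N : ℕ) := by
  have hp0 : p ≠ 0 := by
    rintro rfl
    exact not_lt_bot (degree_zero (R := K) ▸ h)
  rw [degree_eq_natDegree hp0] at h hp
  refine h.trans_le ?_
  exact_mod_cast Nat.lt_succ_iff.mp (by exact_mod_cast hp)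

theorem monic_divByMonic {f p : K[X]} (hf : f.Monic) (hp : p.Monic)
    (h : p.natDegree ≤ f.natDegree) : (f /ₘ p).Monic := by
  rw [Monic, leadingCoeff_divByMonic_of_monic hp, hf]
  rw [degree_eq_natDegree hf.ne_zero, degree_eq_natDegree hp.ne_zero]
  exact_mod_cast h

theorem expCoeff_of_monic (hφ : φ.Monic) (hd : 0 < φ.natDegree) (hq : q.Monic) {k : ℕ}
    (hk : q.natDegree = k * φ.natDegree) : expCoeff φ q k = 1 := by
  have h1 : (q /ₘ φ ^ k).Monic := monic_divByMonic hq (hφ.pow k) (by rw [hφ.natDegree_pow, hk])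
  have h2 : (q /ₘ φ ^ k).natDegree = 0 := by
    rw [natDegree_divByMonic _ (hφ.pow k), hφ.natDegree_pow, hk, Nat.sub_self]
  rw [expCoeff, h1.natDegree_eq_zero.mp h2, modByMonic_eq_self_iff hφ, degree_one]
  exact natDegree_pos_iff_degree_pos.mp hd

theorem IsMinimal.val_le_of_monic (h : IsMinimal ν φ) (hd : 0 < φ.natDegree) (hq : q.Monic) {k : ℕ}
    (hk : q.natDegree = k * φ.natDegree) : ν q ≤ k • ν φ := by
  have := h.le_val_expCoeff q k
  rwa [expCoeff_of_monic h.monic hd hq hk, one_mul, ν.map_pow] at this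

/-- A monic polynomial whose degree is a multiple of that of a minimal one, and whose value is
as large as possible, is minimal. -/
theorem IsMinimal.of_monic (h : IsMinimal ν φ) (hd : 0 < φ.natDegree) (hq : q.Monic) {k : ℕ}
    (hk : q.natDegree = k * φ.natDegree) (hν : k • ν φ ≤ ν q) : IsMinimal ν q := by
  refine ⟨hq, fun f => ?_⟩
  suffices H : ∀ N : ℕ, ∀ f : K[X], f.degree < (N : ℕ) → ν f ≤ ν (f %ₘ q) by
    refine H (f.natDegree + 1) f (degree_le_natDegree.trans_lt ?_)
    exact_mod_cast Nat.lt_succ_self _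
  intro N
  induction N with
  | zero =>
    intro f hf
    have : f = 0 := by simpa [Nat.WithBot.lt_zero_iff] using hf
    simp [this]
  | succ N ih =>
    intro f hf
    by_cases hlt : f.degree < q.degree
    · rw [(modByMonic_eq_self_iff hq).mpr hlt]
    have hf0 : f ≠ 0 := by
      rintro rfl
      exact hlt (by simp [bot_lt_iff_ne_bot, hq.ne_zero])
    have hle : q.natDegree ≤ f.natDegree := natDegree_le_natDegree (not_lt.mp hlt)
    set s := f.natDegree / φ.natDegree
    have hks : k ≤ s := (Nat.le_div_iff_mul_le hd).mpr (hk ▸ hle)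
    have hsd : s * φ.natDegree ≤ f.natDegree := Nat.div_mul_le_self _ _
    have hsd' : f.natDegree < s * φ.natDegree + φ.natDegree := by
      have := Nat.lt_mul_div_succ f.natDegree hd
      rw [mul_add, mul_one, mul_comm] at this
      exact this
    have hle' : (φ ^ s).degree ≤ f.degree := by
      rw [degree_eq_natDegree hf0, degree_eq_natDegree (h.monic.pow s).ne_zero,
        h.monic.natDegree_pow]
      exact_mod_cast hsd
    set c := f /ₘ φ ^ s
    have hcdeg : c.natDegree = f.natDegree - s * φ.natDegree := by
      rw [natDegree_divByMonic _ (h.monic.pow s), h.monic.natDegree_pow]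
    have hclc : c.leadingCoeff = f.leadingCoeff :=
      leadingCoeff_divByMonic_of_monic (h.monic.pow s) hle'
    have hc0 : c ≠ 0 := fun h0 => hf0 (by rwa [h0, leadingCoeff_zero, eq_comm,
      leadingCoeff_eq_zero] at hclc)
    have hcexp : expCoeff φ f s = c := by
      rw [expCoeff, modByMonic_eq_self_iff h.monic]
      apply degree_lt_degree
      rw [hcdeg]
      omega
    have hmon : (φ ^ (s - k) * q).Monic := (h.monic.pow _).mul hq
    have hdeg : (c * (φ ^ (s - k) * q)).degree = f.degree := by
      rw [degree_eq_natDegree hf0, degree_eq_natDegree (mul_ne_zero hc0 hmon.ne_zero),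
        natDegree_mul hc0 hmon.ne_zero, (h.monic.pow _).natDegree_mul hq, h.monic.natDegree_pow, hk,
        ← add_mul, Nat.sub_add_cancel hks, hcdeg, Nat.sub_add_cancel hsd]
    have hlc : f.leadingCoeff = (c * (φ ^ (s - k) * q)).leadingCoeff := by
      rw [leadingCoeff_mul_monic hmon, hclc]
    -- The leading term `c φ^s` of the expansion is traded for `c φ^(s-k) q`, of no smaller value.
    -- Subtracting this multiple of `q` lowers the degree and leaves the remainder unchanged.
    have hdlt := degree_sub_lt_left hdeg.symm hf0 hlc
    have hval : ν f ≤ ν (c * (φ ^ (s - k) * q)) := by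
      refine (h.le_val_expCoeff f s).trans ?_
      rw [hcexp, ν.map_mul, ν.map_mul c, ν.map_mul, ν.map_pow, ν.map_pow]
      refine add_le_add_right ?_ _
      calc s • ν φ = (s - k) • ν φ + k • ν φ := by rw [← add_nsmul, Nat.sub_add_cancel hks]
        _ ≤ _ := add_le_add_right hν _
    have h1 := ih _ (degree_lt_of_lt_of_lt_succ hdlt hf)
    rw [sub_modByMonic, ← mul_assoc, mul_self_modByMonic hq, sub_zero] at h1
    refine le_trans ?_ h1
    rw [mul_assoc]
    exact ν.map_le_sub le_rfl hval

/-- The quotient of `g` by `q^(m-1)` is monic of degree `deg q`, and its remainder modulo `q` is the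
vanishing expansion coefficient. So the quotient is `q` itself, and `g - q^m` is the remainder of
`g` modulo `q^(m-1)`. -/
theorem IsApproxRoot.degree_sub_pow_lt {m : ℕ} (h : IsApproxRoot m g q) (hg : g.Monic)
    (hd : 0 < q.natDegree) : (g - q ^ m).degree < (q ^ (m - 1)).degree := by
  obtain ⟨hm, hq, hdeg, h0⟩ := h
  obtain ⟨m, rfl⟩ : ∃ m', m = m' + 1 := ⟨m - 1, by omega⟩
  rw [Nat.add_sub_cancel] at h0 ⊢
  have h1 : (g /ₘ q ^ m).Monic := monic_divByMonic hg (hq.pow m) (by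
    rw [hq.natDegree_pow, ← hdeg]
    nlinarith)
  have h2 : (g /ₘ q ^ m).natDegree = q.natDegree := by
    rw [natDegree_divByMonic _ (hq.pow m), hq.natDegree_pow, ← hdeg, add_mul, one_mul,
      Nat.add_sub_cancel_left]
  have h3 : ((g /ₘ q ^ m) /ₘ q) = 1 :=
    (monic_divByMonic h1 hq h2.ge).natDegree_eq_zero.mp (by
      rw [natDegree_divByMonic _ hq, h2, Nat.sub_self])
  have h4 := modByMonic_add_div (g /ₘ q ^ m) q
  have h0' : (g /ₘ q ^ m) %ₘ q = 0 := h0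
  rw [h0', h3, mul_one, zero_add] at h4
  have h5 := modByMonic_add_div g (q ^ m)
  rw [← h4, ← pow_succ, eq_comm, ← sub_eq_iff_eq_add] at h5
  rw [h5]
  exact degree_modByMonic_lt _ (hq.pow m)

/-- The difference between the `m`-th powers of two monic polynomials of equal degree is their
difference times `m q^(m-1)`, up to terms of smaller degree. -/
theorem degree_pow_sub_pow_sub_lt {p : K[X]} (hp : p.Monic) (hq : q.Monic)
    (hd : p.natDegree = q.natDegree) (hne : q - p ≠ 0) (m : ℕ) :
    (q ^ (m + 1) - p ^ (m + 1) - ((m + 1 : ℕ) : K[X]) * p ^ m * (q - p)).degree <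
      (p ^ m * (q - p)).degree := by
  have e : q ^ (m + 1) - p ^ (m + 1) - ((m + 1 : ℕ) : K[X]) * p ^ m * (q - p) =
      (∑ i ∈ Finset.range (m + 1), (q ^ i - p ^ i) * p ^ (m - i)) * (q - p) := by
    rw [← (Commute.all q p).geom_sum₂_mul (m + 1), ← sub_mul]
    congr 1
    simp_rw [sub_mul]
    rw [Finset.sum_sub_distrib]
    congr 1
    rw [Finset.sum_congr rfl (g := fun _ => p ^ m), Finset.sum_const, Finset.card_range,
      nsmul_eq_mul]
    intro i hi
    rw [← pow_add]
    congr 1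
    have := Finset.mem_range.mp hi
    omega
  have hlt : (∑ i ∈ Finset.range (m + 1), (q ^ i - p ^ i) * p ^ (m - i)).degree <
      (p ^ m).degree := by
    refine (degree_sum_le _ _).trans_lt ((Finset.sup_lt_iff ?_).mpr fun i hi => ?_)
    · exact bot_lt_iff_ne_bot.mpr (degree_eq_bot.not.mpr (hp.pow m).ne_zero)
    have hi' : i ≤ m := Nat.lt_succ_iff.mp (Finset.mem_range.mp hi)
    have h1 : (q ^ i - p ^ i).degree < (p ^ i).degree := by
      have hdeg : (q ^ i).degree = (p ^ i).degree := by
        rw [degree_eq_natDegree (hq.pow i).ne_zero, degree_eq_natDegree (hp.pow i).ne_zero,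
          hq.natDegree_pow, hp.natDegree_pow, hd]
      rw [← hdeg]
      exact degree_sub_lt_left hdeg (hq.pow i).ne_zero (by rw [hq.pow i, hp.pow i])
    calc _ = (q ^ i - p ^ i).degree + (p ^ (m - i)).degree := degree_mul
      _ < (p ^ i).degree + (p ^ (m - i)).degree :=
        WithBot.add_lt_add_right (degree_eq_bot.not.mpr (hp.pow _).ne_zero) h1
      _ = (p ^ m).degree := by rw [← degree_mul, ← pow_add, Nat.add_sub_cancel' hi']
  rw [e, degree_mul, degree_mul]
  exact WithBot.add_lt_add_right (by simp [degree_eq_bot, hne]) hlt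

/-- The value of an approximate root. -/
theorem IsMinimal.le_val_approxRoot (h : IsMinimal ν φ) (hd : 0 < φ.natDegree) (hφt : ν φ ≠ ⊤)
    {m k : ℕ} (hg : g.Monic) (hk0 : 0 < k) (happ : IsApproxRoot m g q)
    (hk : q.natDegree = k * φ.natDegree)
    (hνg : m • k • ν φ ≤ ν g) (hm : ν (C (m : K)) = 0) : k • ν φ ≤ ν q := by
  have hq := happ.2.1
  have hlow := happ.degree_sub_pow_lt hg (by rw [hk]; positivity)
  have hm0 : (m : K) ≠ 0 := fun h0 => by simp [h0] at hm
  have hminv : 0 ≤ ν (C (m : K)⁻¹) := by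
    have : ν (C (m : K)) + ν (C (m : K)⁻¹) = 0 := by
      rw [← ν.map_mul, ← C_mul, mul_inv_cancel₀ hm0, C_1, ν.map_one]
    rw [hm, zero_add] at this
    exact this.ge
  obtain ⟨m, rfl⟩ : ∃ m', m = m' + 1 := ⟨m - 1, by have := happ.1; omega⟩
  rw [Nat.add_sub_cancel] at hlow
  -- Starting from `p = φ^k`, replace `p` by `p + B / (m+1)`, where `B` is the quotient of `g -
  -- p^(m+1)` by `p^m`. Each step keeps the bound on `ν(p)` and lowers the degree of `q - p`, so `q`
  -- is reached.
  suffices H : ∀ N : ℕ, ∀ p : K[X], p.Monic → p.natDegree = q.natDegree → k • ν φ ≤ ν p →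
      (q - p).degree < (N : ℕ) → k • ν φ ≤ ν q by
    refine H ((q - φ ^ k).natDegree + 1) (φ ^ k) (h.monic.pow k)
      (by rw [h.monic.natDegree_pow, hk]) (by rw [ν.map_pow]) (degree_le_natDegree.trans_lt ?_)
    exact_mod_cast Nat.lt_succ_self _
  intro N
  induction N with
  | zero =>
    intro p _ _ hp hlt
    have : q - p = 0 := by simpa [Nat.WithBot.lt_zero_iff] using hlt
    rwa [sub_eq_zero.mp this]
  | succ N ih =>
    intro p hp hpd hpν hlt
    by_cases hne : q - p = 0
    · rwa [sub_eq_zero.mp hne]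
    have hpν' : ν p = k • ν φ := le_antisymm (h.val_le_of_monic hd hp (hpd.trans hk)) hpν
    -- Minimality of `p^m` ensures that division by it loses no value, which bounds `ν(B)` below.
    have hmin : IsMinimal ν (p ^ m) := h.of_monic hd (hp.pow m) (k := m * k)
      (by rw [hp.natDegree_pow, hpd, hk, mul_assoc]) (by rw [ν.map_pow, mul_nsmul', hpν'])
    have hqp : (q - p).degree < q.degree := by
      have hdeg : q.degree = p.degree := by
        rw [degree_eq_natDegree hq.ne_zero, degree_eq_natDegree hp.ne_zero, hpd]
      exact degree_sub_lt_left hdeg hq.ne_zero (by rw [hq, hp])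
    set f := g - p ^ (m + 1)
    set B := f /ₘ p ^ m
    have hfν : (m + 1) • k • ν φ ≤ ν f := ν.map_le_sub hνg (by rw [ν.map_pow, hpν'])
    have hBν : k • ν φ ≤ ν B := by
      have h1 := hfν.trans (hmin.le_val_mul_div f)
      rw [ν.map_mul, ν.map_pow, hpν', succ_nsmul] at h1
      have hfin : m • k • ν φ ≠ ⊤ := by
        obtain ⟨γ, hγ⟩ := WithTop.ne_top_iff_exists.mp hφt
        rw [← hγ]
        exact WithTop.coe_ne_top (a := m • k • γ)
      exact (WithTop.add_le_add_iff_left hfin).mp h1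
    set E := (g - q ^ (m + 1)) +
      (q ^ (m + 1) - p ^ (m + 1) - ((m + 1 : ℕ) : K[X]) * p ^ m * (q - p))
    have hEdeg : E.degree < (p ^ m * (q - p)).degree := by
      refine (degree_add_le _ _).trans_lt (max_lt (hlow.trans_le ?_)
        (degree_pow_sub_pow_sub_lt hp hq hpd hne m))
      rw [degree_eq_natDegree (hq.pow m).ne_zero,
        degree_eq_natDegree (mul_ne_zero (hp.pow m).ne_zero hne),
        (hp.pow m).natDegree_mul' hne, hp.natDegree_pow, hq.natDegree_pow, hpd]
      exact_mod_cast Nat.le_add_right _ _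
    -- To first order, `B` is the derivative `(m+1)` times the error `q - p`; the remaining quotient
    -- has smaller degree than the error.
    have hBE : B = C ((m + 1 : ℕ) : K) * (q - p) + E /ₘ p ^ m := by
      have e : f = p ^ m * (C ((m + 1 : ℕ) : K) * (q - p)) + E := by
        simp only [f, E, map_natCast]
        ring
      rw [show B = f /ₘ p ^ m from rfl, e, add_divByMonic' (hp.pow m),
        mul_divByMonic_cancel_left _ (hp.pow m)]
    have hE2 : (E /ₘ p ^ m).degree < (q - p).degree := by
      by_cases h0 : E /ₘ p ^ m = 0
      · rw [h0, degree_zero, bot_lt_iff_ne_bot, Ne, degree_eq_bot]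
        exact hne
      have hE0 : E ≠ 0 := by rintro h1; simp [h1] at h0
      have hEn : E.natDegree < (p ^ m * (q - p)).natDegree := natDegree_lt_natDegree hE0 hEdeg
      rw [(hp.pow m).natDegree_mul' hne] at hEn
      apply degree_lt_degree
      rw [natDegree_divByMonic _ (hp.pow m)]
      have : (p ^ m).natDegree ≤ E.natDegree := by
        by_contra hcon
        exact h0 ((divByMonic_eq_zero_iff (hp.pow m)).mpr (degree_lt_degree (not_le.mp hcon)))
      omega
    have hstep : q - (p + C ((m + 1 : ℕ) : K)⁻¹ * B) = - (C ((m + 1 : ℕ) : K)⁻¹ * (E /ₘ p ^ m)) := by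
      rw [hBE, mul_add, ← mul_assoc, ← C_mul, inv_mul_cancel₀ hm0, C_1]
      ring
    have hsdeg : (q - (p + C ((m + 1 : ℕ) : K)⁻¹ * B)).degree < (q - p).degree := by
      rw [hstep, degree_neg, degree_C_mul (inv_ne_zero hm0)]
      exact hE2
    have hp' : p + C ((m + 1 : ℕ) : K)⁻¹ * B = q - (q - (p + C ((m + 1 : ℕ) : K)⁻¹ * B)) := by ring
    have hlt' := hsdeg.trans hqp
    refine ih (p + C ((m + 1 : ℕ) : K)⁻¹ * B) ?_ ?_ ?_ ?_
    · rw [hp']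
      exact hq.sub_of_left hlt'
    · rw [hp']
      exact natDegree_eq_of_degree_eq (degree_sub_eq_left_of_degree_lt hlt')
    · refine ν.map_le_add hpν ?_
      rw [ν.map_mul]
      exact hBν.trans (le_add_of_nonneg_left hminv)
    · exact degree_lt_of_lt_of_lt_succ hsdeg hlt

end Minimal

/-! ### Gauss valuations -/

section Gauss

variable {K Q : Type*} [Field K] [AddCommGroup Q] [LinearOrder Q] [IsOrderedAddMonoid Q]
  {v : AddValuation K (WithTop Q)}

theorem le_gauss_iff {f : K[X]} {x : WithTop Q} : x ≤ gauss v f ↔ ∀ i, x ≤ v (f.coeff i) := by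
  refine ⟨fun h i => ?_, fun h => Finset.le_inf fun i _ => h i⟩
  by_cases hi : i ∈ f.support
  · exact h.trans (Finset.inf_le (f := fun i => v (f.coeff i)) hi)
  · rw [notMem_support_iff.mp hi, v.map_zero]
    exact le_top

theorem gauss_le (f : K[X]) (i : ℕ) : gauss v f ≤ v (f.coeff i) := le_gauss_iff.mp le_rfl i

theorem gauss_zero : gauss v (0 : K[X]) = ⊤ := by simp [gauss]

theorem min_gauss_le_gauss_sub (f g : K[X]) : min (gauss v f) (gauss v g) ≤ gauss v (f - g) :=
  le_gauss_iff.mpr fun i => by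
    rw [coeff_sub]
    exact (min_le_min (gauss_le f i) (gauss_le g i)).trans (v.map_sub _ _)

theorem gauss_map {K' : Type*} [Field K'] {v' : AddValuation K' (WithTop Q)} {i : K →+* K'}
    (hi : ∀ a, v' (i a) = v a) (f : K[X]) : gauss v' (f.map i) = gauss v f := by
  apply le_antisymm
  · exact le_gauss_iff.mpr fun n => by rw [← hi, ← coeff_map]; exact gauss_le _ n
  · exact le_gauss_iff.mpr fun n => by rw [coeff_map, hi]; exact gauss_le _ n

theorem le_gauss_mul {f p : K[X]} {x : WithTop Q} (hf : x ≤ gauss v f) (hp : 0 ≤ gauss v p) :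
    x ≤ gauss v (f * p) := by
  refine le_gauss_iff.mpr fun n => ?_
  rw [coeff_mul]
  refine v.map_le_sum fun ij _ => ?_
  rw [v.map_mul]
  exact (hf.trans (gauss_le f _)).trans (le_add_of_nonneg_right (hp.trans (gauss_le p _)))

theorem le_gauss_mul_pow {f p : K[X]} {x : WithTop Q} (hf : x ≤ gauss v f) (hp : 0 ≤ gauss v p)
    (n : ℕ) : x ≤ gauss v (f * p ^ n) := by
  induction n with
  | zero => simpa using hf
  | succ n ih => rw [pow_succ, ← mul_assoc]; exact le_gauss_mul ih hp

theorem le_gauss_sum {ι : Type*} {s : Finset ι} {f : ι → K[X]} {x : WithTop Q}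
    (h : ∀ i ∈ s, x ≤ gauss v (f i)) : x ≤ gauss v (∑ i ∈ s, f i) :=
  le_gauss_iff.mpr fun n => by
    rw [finsetSum_coeff]
    exact v.map_le_sum fun i hi => (h i hi).trans (gauss_le _ n)

/-- A valuation which is nonnegative at `x` dominates the Gauss valuation. -/
theorem PolyVal.gauss_le_val (ν : PolyVal v) (hX : 0 ≤ ν.val X) (F : K[X]) :
    gauss v F ≤ ν.val F := by
  conv_rhs => rw [F.as_sum_range_C_mul_X_pow]
  refine ν.val.map_le_sum fun i _ => ?_
  rw [ν.val.map_mul, ν.val_C, ν.val.map_pow]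
  exact (gauss_le F i).trans (le_add_of_nonneg_right (nsmul_nonneg hX i))

/-- Some coefficient of an expansion with respect to an integral polynomial has at most the
Gauss value of the whole polynomial. -/
theorem exists_gauss_expCoeff_le {φ : K[X]} (hφ : φ.Monic) (hd : 0 < φ.natDegree)
    (hφint : 0 ≤ gauss v φ) (F : K[X]) : ∃ n, gauss v (expCoeff φ F n) ≤ gauss v F := by
  obtain ⟨n, -, hn⟩ := Finset.exists_mem_eq_inf (Finset.range (F.natDegree + 1)) ⟨0, by simp⟩
    (fun n => gauss v (expCoeff φ F n))
  refine ⟨n, ?_⟩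
  rw [← hn]
  have hdeg : F.degree < ((F.natDegree + 1 : ℕ) : WithBot ℕ) :=
    degree_le_natDegree.trans_lt (by exact_mod_cast Nat.lt_succ_self _)
  conv_rhs => rw [← sum_expCoeff hφ hd hdeg]
  exact le_gauss_sum fun i hi => le_gauss_mul_pow
    (Finset.inf_le (f := fun n => gauss v (expCoeff φ F n)) hi) hφint i

end Gauss

/-! ### Lifting valuations to an immediate extension -/

section Lift

variable {K K' Q : Type*} [Field K] [Field K'] [AddCommGroup Q] [LinearOrder Q]
  [IsOrderedAddMonoid Q] {v : AddValuation K (WithTop Q)} {v' : AddValuation K' (WithTop Q)}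

/-- A function `β` on `K'[x]` which lifts the valuation `μ` on `K[x]`, such that polynomials over
`K'` can be approximated by polynomials over `K` of no larger degree, which is smaller than all
extensions of valuations above `μ`, and which exceeds the Gauss valuation by at most `ρ` per
degree. -/
structure IsLift (v' : AddValuation K' (WithTop Q)) (i : K →+* K') (μ : PolyVal v) (ρ : Q)
    (β : K'[X] → WithTop Q) : Prop where
  map : ∀ f : K[X], β (f.map i) = μ.val f
  min_le_sub : ∀ F G, min (β F) (β G) ≤ β (F - G)
  approx : ∀ F, F ≠ 0 → ∃ f : K[X], f.degree ≤ F.degree ∧ β F < β (F - f.map i)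
  le_val : ∀ ν : PolyVal v, (∀ f, μ.val f ≤ ν.val f) → ∀ ν' : PolyVal v',
    (∀ f : K[X], ν'.val (f.map i) = ν.val f) → ∀ F, β F ≤ ν'.val F
  le_gauss_add : ∀ F, β F ≤ gauss v' F + ((F.natDegree • ρ : Q) : WithTop Q)

variable {i : K →+* K'} {μ ν : PolyVal v} {ρ : Q} {β : K'[X] → WithTop Q}

theorem IsLift.zero (h : IsLift v' i μ ρ β) : β 0 = ⊤ := by
  have := h.map 0
  rwa [Polynomial.map_zero, μ.val.map_zero] at this

theorem IsLift.eq_of_lt_sub (h : IsLift v' i μ ρ β) {F G : K'[X]} (hlt : β F < β (F - G)) :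
    β G = β F := by
  apply le_antisymm
  · by_contra! hcon
    have h1 := h.min_le_sub 0 G
    rw [h.zero, min_eq_right le_top] at h1
    have h2 := h.min_le_sub (F - G) (0 - G)
    rw [show F - G - (0 - G) = F by ring] at h2
    exact (lt_min hlt (hcon.trans_le h1)).not_ge h2
  · have h2 := h.min_le_sub F (F - G)
    rwa [sub_sub_cancel, min_eq_left hlt.le] at h2

/-- Every extension of `μ` agrees with the lift. -/
theorem IsLift.eq_val (h : IsLift v' i μ ρ β) (μ' : PolyVal v')
    (hμ' : ∀ f : K[X], μ'.val (f.map i) = μ.val f) (F : K'[X]) : μ'.val F = β F := by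
  by_cases hF : F = 0
  · rw [hF, h.zero, μ'.val.map_zero]
  obtain ⟨f, -, hf⟩ := h.approx F hF
  have h1 : μ'.val (f.map i) = β F := by
    rw [hμ', ← h.map, h.eq_of_lt_sub hf]
  -- Since `β` bounds the extension below, an approximation for `β` is also one for the extension,
  -- and both agree on polynomials over `K`.
  have h2 : β F < μ'.val (F - f.map i) :=
    hf.trans_le (h.le_val μ (fun _ => le_rfl) μ' hμ' _)
  rw [← h1] at h2 ⊢
  exact μ'.val.map_eq_of_lt_sub h2

theorem isLift_gauss (hi : ∀ a, v' (i a) = v a)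
    (himm : ∀ c : K', c ≠ 0 → ∃ a : K, v' c < v' (c - i a)) (hμ : ∀ f, μ.val f = gauss v f) :
    IsLift v' i μ 0 (gauss v') where
  map f := by rw [hμ, gauss_map hi]
  min_le_sub := min_gauss_le_gauss_sub
  approx F hF := by
    have hex : ∀ c : K', ∃ a : K, (c = 0 → a = 0) ∧ (c ≠ 0 → v' c < v' (c - i a)) := fun c => by
      by_cases hc : c = 0
      · exact ⟨0, fun _ => rfl, fun h => absurd hc h⟩
      · obtain ⟨a, ha⟩ := himm c hc
        exact ⟨a, fun h => absurd h hc, fun _ => ha⟩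
    choose a ha0 ha using hex
    set f : K[X] := ∑ n ∈ Finset.range (F.natDegree + 1), monomial n (a (F.coeff n))
    have hcoeff : ∀ n, f.coeff n = a (F.coeff n) := fun n => by
      simp only [f, finsetSum_coeff, coeff_monomial, Finset.sum_ite_eq', Finset.mem_range]
      split_ifs with h
      · rfl
      · rw [ha0 _ (coeff_eq_zero_of_natDegree_lt (by omega))]
    have hFtop : gauss v' F < ⊤ := (gauss_le F F.natDegree).trans_lt
      (lt_top_iff_ne_top.mpr (v'.ne_top_iff.mpr (by simpa using hF)))
    refine ⟨f, (degree_le_iff_coeff_zero _ _).mpr fun n hn => ?_, ?_⟩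
    · rw [hcoeff, ha0 _ (coeff_eq_zero_of_degree_lt hn)]
    · refine (Finset.lt_inf_iff hFtop).mpr fun n _ => ?_
      rw [coeff_sub, coeff_map, hcoeff]
      by_cases hn : F.coeff n = 0
      · rw [hn, ha0 _ rfl, map_zero, sub_zero, v'.map_zero]
        exact hFtop
      · exact (gauss_le F n).trans_lt (ha _ hn)
  le_val ν hν ν' hν' F := by
    apply ν'.gauss_le_val
    have h1 := hν' X
    rw [map_X] at h1
    rw [h1]
    refine le_trans ?_ (hν X)
    rw [hμ]
    refine le_gauss_iff.mpr fun n => ?_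
    rw [coeff_X]
    split_ifs <;> simp
  le_gauss_add F := by simp

/-- The lift of an augmentation. -/
theorem IsLift.augmentation (h : IsLift v' i μ ρ β) {φ : K[X]} (hi : ∀ a, v' (i a) = v a)
    (hφ : φ.Monic) (hd : 0 < φ.natDegree) (hφint : 0 ≤ gauss v φ) {lam ρ' : Q} (hρ0 : 0 ≤ ρ)
    (hρ : ρ ≤ ρ') (hρ' : φ.natDegree • ρ' = lam) (hν : IsAugmentation μ φ lam ν)
    (hle : ∀ f, μ.val f ≤ ν.val f) :
    IsLift v' i ν ρ' (augFun β (φ.map i) lam) := by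
  have hφ' : (φ.map i).Monic := hφ.map i
  have hdeg : (φ.map i).natDegree = φ.natDegree := hφ.natDegree_map i
  have hd' : 0 < (φ.map i).natDegree := hdeg ▸ hd
  have hlamφ : (lam : WithTop Q) ≤ ν.val φ := by
    rw [hν φ]
    exact (augFun_self (β := μ.val) hφ hd μ.val.map_zero μ.val.map_one).ge
  refine ⟨fun f => ?_, fun F G => ?_, fun F hF => ?_, fun ν₁ hν₁ ν' hν' F => ?_, fun F => ?_⟩
  · rw [hν f, augFun, natDegree_map]
    exact Finset.inf_congr rfl fun n _ => by rw [expCoeff_map i hφ, h.map]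
  · refine le_augFun fun n => ?_
    rw [expCoeff_sub hφ']
    refine le_trans ?_ (add_le_add_left (h.min_le_sub _ _) _)
    rw [← min_add_add_right]
    exact min_le_min (augFun_le hφ' hd' h.zero F n) (augFun_le hφ' hd' h.zero G n)
  -- The coefficients are approximated one by one. The degree bound in `approx` keeps the
  -- approximants below `deg φ`, so they are the coefficients of an expansion again.
  · have hex : ∀ n, ∃ a : K[X], (expCoeff (φ.map i) F n = 0 → a = 0) ∧
        (expCoeff (φ.map i) F n ≠ 0 → a.degree ≤ (expCoeff (φ.map i) F n).degree ∧
          β (expCoeff (φ.map i) F n) < β (expCoeff (φ.map i) F n - a.map i)) := fun n => by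
      by_cases hc : expCoeff (φ.map i) F n = 0
      · exact ⟨0, fun _ => rfl, fun h => absurd hc h⟩
      · obtain ⟨a, ha⟩ := h.approx _ hc
        exact ⟨a, fun h => absurd h hc, fun _ => ha⟩
    choose a ha0 ha using hex
    have hadeg : ∀ n, (a n).degree ≤ (expCoeff (φ.map i) F n).degree := fun n => by
      by_cases hc : expCoeff (φ.map i) F n = 0
      · rw [hc, ha0 n hc, degree_zero, degree_zero]
      · exact (ha n hc).1
    have hadeg' : ∀ n, (a n).degree < φ.degree := fun n => (hadeg n).trans_lt (by
      have := degree_expCoeff_lt hφ' F n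
      rwa [degree_map] at this)
    set f : K[X] := ∑ n ∈ Finset.range (F.natDegree + 1), a n * φ ^ n
    have hcoeff : ∀ n, expCoeff φ f n = a n := fun n => by
      rw [expCoeff_sum hφ hadeg']
      split_ifs with hn
      · rfl
      · rw [ha0 n (expCoeff_eq_zero hφ' (by nlinarith))]
    obtain ⟨n₀, hn₀⟩ : ∃ n, expCoeff (φ.map i) F n ≠ 0 := by
      by_contra! hcon
      have hlt : F.degree < ((F.natDegree + 1 : ℕ) : WithBot ℕ) :=
        degree_le_natDegree.trans_lt (by exact_mod_cast Nat.lt_succ_self _)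
      exact hF (by rw [← sum_expCoeff hφ' hd' hlt]; simp [hcon])
    have hFtop : augFun β (φ.map i) lam F < ⊤ :=
      (augFun_le hφ' hd' h.zero F n₀).trans_lt
        (WithTop.add_lt_top.mpr ⟨(ha n₀ hn₀).2.trans_le le_top, WithTop.coe_lt_top _⟩)
    refine ⟨f, (degree_sum_le _ _).trans (Finset.sup_le fun n _ => ?_),
      (Finset.lt_inf_iff hFtop).mpr fun n _ => ?_⟩
    · by_cases hc : a n = 0
      · simp [hc]
      have hc' : expCoeff (φ.map i) F n ≠ 0 := fun h0 => hc (ha0 n h0)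
      have h1 := natDegree_expCoeff_add_le hφ' hc'
      have h2 := natDegree_le_natDegree (hadeg n)
      rw [degree_eq_natDegree (mul_ne_zero hc (hφ.pow n).ne_zero), degree_eq_natDegree hF,
        natDegree_mul hc (hφ.pow n).ne_zero, hφ.natDegree_pow]
      rw [hdeg] at h1
      exact_mod_cast (add_le_add_left h2 _).trans h1
    · rw [expCoeff_sub hφ', expCoeff_map i hφ, hcoeff]
      by_cases hc : expCoeff (φ.map i) F n = 0
      · rw [hc, ha0 n hc, Polynomial.map_zero, sub_zero, h.zero, top_add]
        exact hFtop
      · exact (augFun_le hφ' hd' h.zero F n).trans_lt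
          (WithTop.add_lt_add_right WithTop.coe_ne_top (ha n hc).2)
  · have hlt : F.degree < ((F.natDegree + 1 : ℕ) : WithBot ℕ) :=
      degree_le_natDegree.trans_lt (by exact_mod_cast Nat.lt_succ_self _)
    conv_rhs => rw [← sum_expCoeff hφ' hd' hlt]
    refine ν'.val.map_le_sum fun n _ => (augFun_le hφ' hd' h.zero F n).trans ?_
    rw [ν'.val.map_mul, ν'.val.map_pow, hν']
    refine add_le_add (h.le_val ν₁ (fun f => (hle f).trans (hν₁ f)) ν' hν' _) ?_
    exact nsmul_le_nsmul_right (hlamφ.trans (hν₁ φ)) n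
  -- One term suffices, since the formula is a minimum: the coefficient contributes its degree times
  -- `ρ ≤ ρ'`, and `n λ = n deg φ ρ'`.
  · obtain ⟨n, hn⟩ := exists_gauss_expCoeff_le hφ' hd' (by rwa [gauss_map hi]) F
    by_cases hc : expCoeff (φ.map i) F n = 0
    · rw [hc, gauss_zero, top_le_iff] at hn
      rw [hn, top_add]
      exact le_top
    have h1 := natDegree_expCoeff_add_le hφ' hc
    rw [hdeg] at h1
    refine (augFun_le hφ' hd' h.zero F n).trans ?_
    refine (add_le_add_left (h.le_gauss_add _) _).trans ?_
    rw [add_assoc]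
    refine add_le_add hn ?_
    rw [← WithTop.coe_add, WithTop.coe_le_coe, ← hρ', ← mul_nsmul']
    calc _ ≤ (expCoeff (φ.map i) F n).natDegree • ρ' + (n * φ.natDegree) • ρ' :=
          add_le_add_left (nsmul_le_nsmul_right hρ _) _
      _ = ((expCoeff (φ.map i) F n).natDegree + n * φ.natDegree) • ρ' := (add_nsmul _ _ _).symm
      _ ≤ F.natDegree • ρ' := nsmul_le_nsmul_left (hρ0.trans hρ) h1

end Lift

/-! ### Newton polygons -/

section Newton

variable {K Q : Type*} [Field K] [AddCommGroup Q] [LinearOrder Q] [IsOrderedAddMonoid Q]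
  [Module ℚ Q] [IsStrictOrderedModule ℚ Q] {v : AddValuation K (WithTop Q)}

theorem le_of_mem_convexHull {c : Set (ℚ × Q)} {lam x : Q}
    (h : ∀ P ∈ c, x ≤ P.2 + P.1 • lam) {P : ℚ × Q} (hP : P ∈ convexHull ℚ c) :
    x ≤ P.2 + P.1 • lam := by
  have hlin : IsLinearMap ℚ fun P : ℚ × Q => P.2 + P.1 • lam :=
    ⟨fun P P' => by simp only [Prod.snd_add, Prod.fst_add, add_smul]; abel,
      fun r P => by simp only [Prod.smul_snd, Prod.smul_fst, smul_add, smul_assoc]⟩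
  exact convexHull_min (t := {P : ℚ × Q | x ≤ P.2 + P.1 • lam}) h
    (convex_halfSpace_ge hlin x) hP

theorem fst_le_of_mem_convexHull {c : Set (ℚ × Q)} {x : ℚ} (h : ∀ P ∈ c, P.1 ≤ x) {P : ℚ × Q}
    (hP : P ∈ convexHull ℚ c) : P.1 ≤ x :=
  convexHull_min (t := {P : ℚ × Q | P.1 ≤ x}) h
    (convex_halfSpace_le (f := fun P : ℚ × Q => P.1) ⟨fun _ _ => rfl, fun _ _ => rfl⟩ x) hP

/-- On the boundary line of abscissa `0`, a convex combination involves with positive weight only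
points of that line. -/
theorem lt_snd_of_mem_convexHull {c : Set (ℚ × Q)} {x : Q} (h0 : ∀ P ∈ c, 0 ≤ P.1)
    (h : ∀ P ∈ c, P.1 = 0 → x < P.2) {P : ℚ × Q} (hP : P ∈ convexHull ℚ c) (hP0 : P.1 = 0) :
    x < P.2 := by
  have hconv : Convex ℚ {P : ℚ × Q | 0 ≤ P.1 ∧ (P.1 = 0 → x < P.2)} := by
    rintro P ⟨hP1, hP2⟩ P' ⟨hP1', hP2'⟩ a b ha hb hab
    have h1 : 0 ≤ a * P.1 := mul_nonneg ha hP1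
    have h2 : 0 ≤ b * P'.1 := mul_nonneg hb hP1'
    refine ⟨add_nonneg h1 h2, fun hsum => ?_⟩
    have hsum' : a * P.1 + b * P'.1 = 0 := hsum
    change x < a • P.2 + b • P'.2
    have ex : x = a • x + b • x := by rw [← add_smul, hab, one_smul]
    rcases ha.eq_or_lt with rfl | ha'
    · rw [zero_add] at hab
      subst hab
      simpa using hP2' (by linarith)
    rcases hb.eq_or_lt with rfl | hb'
    · rw [add_zero] at hab
      subst hab
      simpa using hP2 (by linarith)
    have e1 : P.1 = 0 := by
      have : a * P.1 = 0 := by linarith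
      exact (mul_eq_zero.mp this).resolve_left ha'.ne'
    have e2 : P'.1 = 0 := by
      have : b * P'.1 = 0 := by linarith
      exact (mul_eq_zero.mp this).resolve_left hb'.ne'
    rw [ex]
    exact add_lt_add (smul_lt_smul_of_pos_left (hP2 e1) ha')
      (smul_lt_smul_of_pos_left (hP2' e2) hb')
  exact (convexHull_min (t := {P : ℚ × Q | 0 ≤ P.1 ∧ (P.1 = 0 → x < P.2)})
    (fun P hP => ⟨h0 P hP, h P hP⟩) hconv hP).2 hP0

variable {μ : PolyVal v} {φ g : K[X]} {n : ℕ} {θ lam : Q}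

/-- The hypotheses under which the Newton polygon is studied: the `φ`-expansion of `g` has leading
term `φ^n`, and no term has value smaller than `φ^n`. -/
structure HasExpansion (μ : PolyVal v) (φ g : K[X]) (n : ℕ) (θ : Q) : Prop where
  monic : φ.Monic
  pos : 0 < φ.natDegree
  monic_right : g.Monic
  natDegree_eq : g.natDegree = n * φ.natDegree
  le_val : ∀ j, ((n • θ : Q) : WithTop Q) ≤ μ.val (expCoeff φ g j) + ((j • θ : Q) : WithTop Q)

theorem HasExpansion.val_expCoeff (h : HasExpansion μ φ g n θ) : μ.val (expCoeff φ g n) = 0 := by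
  rw [expCoeff_of_monic h.monic h.pos h.monic_right h.natDegree_eq, μ.val.map_one]

theorem HasExpansion.mem_cloud (h : HasExpansion μ φ g n θ) :
    ((n : ℚ), (0 : Q)) ∈ newtonCloud μ φ g :=
  ⟨n, rfl, h.val_expCoeff⟩

theorem HasExpansion.fst_le (h : HasExpansion μ φ g n θ) {P : ℚ × Q}
    (hP : P ∈ newtonCloud μ φ g) : P.1 ≤ n := by
  obtain ⟨j, hj, hval⟩ := hP
  rw [hj]
  by_contra! hcon
  have hcon' : n < j := by exact_mod_cast hcon
  rw [expCoeff_eq_zero h.monic (by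
    rw [h.natDegree_eq]; exact Nat.mul_lt_mul_of_pos_right hcon' h.pos), μ.val.map_zero] at hval
  exact WithTop.coe_ne_top hval.symm

theorem le_of_mem_cloud {x : Q}
    (h : ∀ j, (x : WithTop Q) ≤ μ.val (expCoeff φ g j) + ((j • lam : Q) : WithTop Q)) {P : ℚ × Q}
    (hP : P ∈ newtonCloud μ φ g) : x ≤ P.2 + P.1 • lam := by
  obtain ⟨j, hj, hval⟩ := hP
  have h1 := h j
  rw [hval] at h1
  rw [hj, Nat.cast_smul_eq_nsmul]
  exact_mod_cast h1

theorem HasExpansion.mem_newtonPolygon (h : HasExpansion μ φ g n θ) :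
    ((n : ℚ), (0 : Q)) ∈ newtonPolygon μ φ g := by
  refine ⟨subset_convexHull ℚ _ h.mem_cloud, fun P' hP' hfst => ?_⟩
  have h1 := le_of_mem_convexHull (fun P hP => le_of_mem_cloud h.le_val hP) hP'
  rw [hfst, Nat.cast_smul_eq_nsmul] at h1
  exact nonneg_of_le_add_left h1

/-- Let `(s, α)` be the left one of two points of the side, so `s < n`. Minimality against `(n, 0)`
gives `α ≤ (n - s) λ`, while `le_val` gives `(n - s) θ ≤ α`. -/
theorem HasExpansion.le_of_hasSide (h : HasExpansion μ φ g n θ)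
    (hside : HasSide (newtonPolygon μ φ g) lam) : θ ≤ lam := by
  obtain ⟨P, hP, P', hP', hlt⟩ := hside
  have h1 := hP.2 _ h.mem_newtonPolygon
  have h2 := le_of_mem_convexHull (fun P hP => le_of_mem_cloud h.le_val hP) hP.1.1
  have h3 := fst_le_of_mem_convexHull (fun P hP => h.fst_le hP) hP'.1.1
  simp only [zero_add] at h1
  rw [← Nat.cast_smul_eq_nsmul ℚ] at h2
  have hpos : 0 < (n : ℚ) - P.1 := by linarith
  have h4 : ((n : ℚ) - P.1) • θ ≤ ((n : ℚ) - P.1) • lam := by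
    rw [sub_smul, sub_smul]
    exact (sub_le_iff_le_add.mpr h2).trans (le_sub_iff_add_le.mpr h1)
  exact le_of_smul_le_smul_left h4 hpos

/-- The terms of the expansion when the Newton polygon is one-sided. -/
theorem HasExpansion.of_isOneSided (h : HasExpansion μ φ g n θ)
    (hone : IsOneSided (newtonPolygon μ φ g) lam) :
    HasSide (newtonPolygon μ φ g) lam ∧
    augFun μ.val φ lam g = ((n • lam : Q) : WithTop Q) ∧
      μ.val (expCoeff φ g 0) = ((n • lam : Q) : WithTop Q) := by
  obtain ⟨heq, ⟨⟨P₀, hP₀, hfst⟩, -⟩, P₁, hP₁, hpos⟩ := hone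
  have hn : ((n : ℚ), (0 : Q)) ∈ component (newtonPolygon μ φ g) lam := heq ▸ h.mem_newtonPolygon
  have htop : augFun μ.val φ lam g = ((n • lam : Q) : WithTop Q) := by
    apply le_antisymm
    · have h1 := augFun_le (β := μ.val) (γ := lam) h.monic h.pos μ.val.map_zero g n
      rwa [h.val_expCoeff, zero_add] at h1
    -- An index attaining a smaller minimum would give a point of the polygon below the line of
    -- slope `-λ` through `(n, 0)`.
    by_contra! hcon
    obtain ⟨j, hj⟩ := exists_augFun_eq (β := μ.val) (φ := φ) (γ := lam) g
    have hfin : μ.val (expCoeff φ g j) ≠ ⊤ := by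
      intro htop
      rw [hj, htop, top_add] at hcon
      exact not_top_lt hcon
    obtain ⟨α, hα⟩ := WithTop.ne_top_iff_exists.mp hfin
    rw [← hα] at hj
    have hj' : augFun μ.val φ lam g = ((α + j • lam : Q) : WithTop Q) := hj
    have hmin : ∀ P ∈ convexHull ℚ (newtonCloud μ φ g), α + j • lam ≤ P.2 + P.1 • lam :=
      fun P hP => le_of_mem_convexHull (fun P hP => le_of_mem_cloud (fun k => by
        rw [← hj']
        exact augFun_le h.monic h.pos μ.val.map_zero g k) hP) hP
    have hmem : ((j : ℚ), α) ∈ newtonPolygon μ φ g := by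
      refine ⟨subset_convexHull ℚ _ ⟨j, rfl, hα.symm⟩, fun P' hP' he => ?_⟩
      have := hmin P' hP'
      rw [he, Nat.cast_smul_eq_nsmul] at this
      exact le_of_add_le_add_right this
    have h1 := hn.2 _ hmem
    simp only [zero_add] at h1
    rw [Nat.cast_smul_eq_nsmul, Nat.cast_smul_eq_nsmul] at h1
    rw [hj'] at hcon
    exact (WithTop.coe_lt_coe.mp hcon).not_ge h1
  refine ⟨⟨P₀, hP₀, P₁, hP₁, by rw [hfst]; exact hpos⟩, htop, ?_⟩
  have hle := augFun_le (β := μ.val) (γ := lam) h.monic h.pos μ.val.map_zero g 0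
  rw [htop, zero_smul, WithTop.coe_zero, add_zero] at hle
  by_contra hne
  have hlt := lt_of_le_of_ne hle (Ne.symm hne)
  -- If `μ(a_0)` exceeded `n λ`, the left end point of the polygon would lie strictly above the side
  -- that contains it.
  have h2 := lt_snd_of_mem_convexHull (x := n • lam) (c := newtonCloud μ φ g) (P := P₀)
    (fun P hP => by
      obtain ⟨j, hj, -⟩ := hP
      rw [hj]
      positivity)
    (fun P hP hP0 => by
      obtain ⟨j, hj, hval⟩ := hP
      have hj0 : j = 0 := by exact_mod_cast hj.symm.trans hP0
      rw [hj0] at hval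
      rw [hval] at hlt
      exact_mod_cast hlt) hP₀.1.1 hfst
  have h3 := hP₀.2 _ hn.1
  rw [hfst, zero_smul, add_zero, zero_add, Nat.cast_smul_eq_nsmul] at h3
  exact h2.not_ge h3

end Newton

/-! ### The degree of the residual polynomial -/

section Residual

variable {K Q : Type*} [Field K] [AddCommGroup Q] [LinearOrder Q] [IsOrderedAddMonoid Q]
  {v : AddValuation K (WithTop Q)}

theorem PolyVal.toFrac_ne_zero (μ : PolyVal v) {f : K[X]} (hf : μ.val f ≠ ⊤) :
    μ.toFrac f ≠ 0 := by
  intro h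
  have h1 := μ.fracVal_toFrac f
  rw [h, map_zero] at h1
  exact hf (by simpa using congrArg (fun t => OrderDual.ofDual (Multiplicative.toAdd t)) h1.symm)

theorem PolyVal.residue_one (μ : PolyVal v) : μ.residue 1 = 1 := by
  rw [PolyVal.residue, dif_pos (one_mem _)]
  exact map_one (IsLocalRing.residue μ.fracRing)

/-- The degree of the residual polynomial of an expansion with extreme terms `0` and `n`. -/
theorem PolyVal.natDegree_residualPoly (μ : PolyVal v) {φ U g : K[X]} {n : ℕ}
    (h0 : 0 ∈ μ.levelSet φ g) (hn : n ∈ μ.levelSet φ g) (hle : ∀ j ∈ μ.levelSet φ g, j ≤ n)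
    (hdvd : μ.eRel φ ∣ n) (ha : μ.val (expCoeff φ g n) ≠ ⊤) :
    (μ.residualPoly φ U g).natDegree = n / μ.eRel φ := by
  have hne : (μ.levelSet φ g).Nonempty := ⟨0, h0⟩
  have hmin : (μ.levelSet φ g).min' hne = 0 := Nat.le_zero.mp (Finset.min'_le _ _ h0)
  have hmax : (μ.levelSet φ g).max' hne = n :=
    le_antisymm (Finset.max'_le _ _ _ hle) (Finset.le_max' _ _ hn)
  have ha0 := μ.toFrac_ne_zero ha
  rw [PolyVal.residualPoly, dif_pos hne]
  simp only [hmin, hmax, Nat.sub_zero, zero_add]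
  apply natDegree_eq_of_le_of_coeff_ne_zero
  · refine natDegree_sum_le_of_forall_le _ _ fun j hj => ?_
    split_ifs
    · exact (natDegree_monomial_le _).trans (Nat.lt_succ_iff.mp (Finset.mem_range.mp hj))
    · simp
  · rw [finsetSum_coeff, Finset.sum_eq_single (n / μ.eRel φ)]
    · rw [Nat.div_mul_cancel hdvd, if_pos hn, coeff_monomial, if_pos rfl, Nat.sub_self, pow_zero,
        mul_one, div_self ha0, residue_one]
      exact one_ne_zero
    · intro j _ hj
      split_ifs
      · rw [coeff_monomial, if_neg hj]
      · simp
    · intro h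
      exact absurd (Finset.mem_range.mpr (Nat.lt_succ_self _)) h

/-- The degree `n / e` of the residual polynomial equals `m deg ψ`; this determines the degree of
the next key polynomial. -/
theorem PolyVal.ResidualIsPower.exists_eq_mul {μ : PolyVal v} {φ g : K[X]} {n m : ℕ}
    (h : μ.ResidualIsPower φ g m)
    (h0 : 0 ∈ μ.levelSet φ g) (hn : n ∈ μ.levelSet φ g) (hle : ∀ j ∈ μ.levelSet φ g, j ≤ n)
    (hdvd : μ.eRel φ ∣ n) (ha : μ.val (expCoeff φ g n) ≠ ⊤) :
    ∃ d, 0 < d ∧ n = m * (μ.eRel φ * d) := by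
  obtain ⟨U, -, -, ψ, hψ, hirr, hR⟩ := h
  refine ⟨ψ.natDegree, hirr.natDegree_pos, ?_⟩
  have h1 := μ.natDegree_residualPoly (U := U) h0 hn hle hdvd ha
  rw [hR, natDegree_map, hψ.natDegree_pow] at h1
  rw [mul_left_comm, h1, Nat.mul_div_cancel' hdvd]

end Residual

/-! ### The invariants of the irreducibility test -/

section Chain

variable {K Q : Type*} [Field K] [AddCommGroup Q] [LinearOrder Q] [IsOrderedAddMonoid Q]
  {v : AddValuation K (WithTop Q)} {μ ν : PolyVal v} {φ : K[X]} {lam : Q}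

theorem IsAugmentation.val_eq (h : IsAugmentation μ φ lam ν) (hφ : φ.Monic) (hd : 0 < φ.natDegree)
    {a : K[X]} (ha : a.degree < φ.degree) : ν.val a = μ.val a :=
  (h a).trans (augFun_of_degree_lt (β := μ.val) hφ hd μ.val.map_zero ha)

theorem IsAugmentation.val_self (h : IsAugmentation μ φ lam ν) (hφ : φ.Monic)
    (hd : 0 < φ.natDegree) : ν.val φ = lam :=
  (h φ).trans (augFun_self (β := μ.val) hφ hd μ.val.map_zero μ.val.map_one)

theorem IsAugmentation.isMinimal (h : IsAugmentation μ φ lam ν) (hφ : φ.Monic)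
    (hd : 0 < φ.natDegree) : IsMinimal ν.val φ := by
  refine ⟨hφ, fun f => ?_⟩
  rw [h.val_eq hφ hd (degree_modByMonic_lt _ hφ), h f]
  exact (augFun_le (β := μ.val) hφ hd μ.val.map_zero f 0).trans (by simp [expCoeff_zero_right])

theorem IsAugmentation.val_le (h : IsAugmentation μ φ lam ν) (hmin : IsMinimal μ.val φ)
    (hlam : μ.val φ ≤ lam) (f : K[X]) : μ.val f ≤ ν.val f := by
  rw [h f]
  refine le_augFun (β := μ.val) fun n => (hmin.le_val_expCoeff f n).trans ?_
  rw [μ.val.map_mul, μ.val.map_pow]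
  exact add_le_add_right (nsmul_le_nsmul_right hlam n) _

/-- The group of finite values of a valuation on `K[x]`, when every element of `Q` has a positive
multiple which is a value of `v`. -/
def PolyVal.valueGroup (μ : PolyVal v)
    (htor : ∀ γ : Q, ∃ N : ℕ, 0 < N ∧ ∃ a : K, v a = ((N • γ : Q) : WithTop Q)) :
    AddSubgroup Q where
  carrier := {γ | ∃ f, μ.val f = γ}
  zero_mem' := ⟨1, by simp⟩
  add_mem' := by
    rintro γ δ ⟨f, hf⟩ ⟨p, hp⟩
    exact ⟨f * p, by rw [μ.val.map_mul, hf, hp, WithTop.coe_add]⟩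
  neg_mem' := by
    rintro γ ⟨f, hf⟩
    obtain ⟨N, hN, a, ha⟩ := htor (-γ)
    obtain ⟨N, rfl⟩ : ∃ m, N = m + 1 := ⟨N - 1, by omega⟩
    refine ⟨f ^ N * C a, ?_⟩
    rw [μ.val.map_mul, μ.val.map_pow, hf, μ.val_C, ha, ← WithTop.coe_nsmul, ← WithTop.coe_add,
      succ_nsmul, smul_neg, add_neg_cancel_left]

/-- The set of values of polynomials of degree less than `deg φ` is the whole value group. -/
def HasValues (μ : PolyVal v) (φ : K[X]) : Prop :=
  ∀ (f : K[X]) (γ : Q), μ.val f = γ → ∃ a : K[X], a.degree < φ.degree ∧ μ.val a = γ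

theorem IsAugmentation.exists_iff_mem (h : IsAugmentation μ φ lam ν) (hφ : φ.Monic)
    (hd : 0 < φ.natDegree) (hval : HasValues μ φ)
    (htor : ∀ γ : Q, ∃ N : ℕ, 0 < N ∧ ∃ a : K, v a = ((N • γ : Q) : WithTop Q)) (n : ℕ) :
    (∃ a : K[X], a ≠ 0 ∧ a.degree < φ.degree ∧ ν.val a = n • ν.val φ) ↔
      n • lam ∈ μ.valueGroup htor := by
  rw [h.val_self hφ hd, ← WithTop.coe_nsmul]
  constructor
  · rintro ⟨a, -, ha, hva⟩
    exact ⟨a, by rw [← hva, h.val_eq hφ hd ha]⟩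
  · rintro ⟨f, hf⟩
    obtain ⟨a, ha, hva⟩ := hval f _ hf
    refine ⟨a, ?_, ha, by rw [h.val_eq hφ hd ha, hva]⟩
    rintro rfl
    rw [μ.val.map_zero] at hva
    exact WithTop.coe_ne_top hva.symm

/-- The relative ramification index divides all `n` such that `n ν(φ)` is a value of `μ`. -/
theorem IsAugmentation.eRel_spec (h : IsAugmentation μ φ lam ν) (hφ : φ.Monic)
    (hd : 0 < φ.natDegree) (hval : HasValues μ φ)
    (htor : ∀ γ : Q, ∃ N : ℕ, 0 < N ∧ ∃ a : K, v a = ((N • γ : Q) : WithTop Q)) {n : ℕ}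
    (hn : 0 < n) (hmem : n • lam ∈ μ.valueGroup htor) :
    0 < ν.eRel φ ∧ ν.eRel φ • lam ∈ μ.valueGroup htor ∧ ν.eRel φ ∣ n := by
  have hset : {n | 0 < n ∧ ∃ a : K[X], a ≠ 0 ∧ a.degree < φ.degree ∧ ν.val a = n • ν.val φ} =
      {n | 0 < n ∧ n • lam ∈ μ.valueGroup htor} := by
    ext n
    exact and_congr_right fun _ => h.exists_iff_mem hφ hd hval htor n
  have hdef : ν.eRel φ = sInf {n | 0 < n ∧ n • lam ∈ μ.valueGroup htor} := by
    rw [PolyVal.eRel, hset]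
  obtain ⟨h1, h2⟩ : ν.eRel φ ∈ {n | 0 < n ∧ n • lam ∈ μ.valueGroup htor} :=
    hdef ▸ Nat.sInf_mem ⟨n, hn, hmem⟩
  refine ⟨h1, h2, Nat.dvd_of_mod_eq_zero ?_⟩
  by_contra h0
  have hmod : (n % ν.eRel φ) • lam ∈ μ.valueGroup htor := by
    have e : (n % ν.eRel φ) • lam = n • lam - (n / ν.eRel φ) • ν.eRel φ • lam := by
      rw [eq_sub_iff_add_eq, ← mul_nsmul', ← add_nsmul, mul_comm, Nat.mod_add_div]
    rw [e]
    exact sub_mem hmem (nsmul_mem h2 _)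
  have hle : ν.eRel φ ≤ n % ν.eRel φ := by
    conv_lhs => rw [hdef]
    exact Nat.sInf_le ⟨Nat.pos_of_ne_zero h0, hmod⟩
  exact (Nat.mod_lt n h1).not_ge hle

/-- A value `α + j λ` is rewritten with `j` reduced modulo `e`, the multiple of `e λ` being absorbed
by a coefficient `b`. Then `b φ^(j % e)` has degree less than `e deg φ`. -/
theorem IsAugmentation.hasValues (h : IsAugmentation μ φ lam ν) (hφ : φ.Monic)
    (hd : 0 < φ.natDegree) (hval : HasValues μ φ)
    (htor : ∀ γ : Q, ∃ N : ℕ, 0 < N ∧ ∃ a : K, v a = ((N • γ : Q) : WithTop Q))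
    {e : ℕ} (he : 0 < e) (hmem : e • lam ∈ μ.valueGroup htor) {q : K[X]}
    (hq : e * φ.natDegree ≤ q.natDegree) : HasValues ν q := by
  intro f γ hf
  obtain ⟨j, hj⟩ := exists_augFun_eq (β := μ.val) (φ := φ) (γ := lam) f
  rw [h f] at hf
  have hf' := hj.symm.trans hf
  have hfin : μ.val (expCoeff φ f j) ≠ ⊤ := by
    intro htop
    rw [htop, top_add] at hf'
    exact WithTop.coe_ne_top hf'.symm
  obtain ⟨α, hα⟩ := WithTop.ne_top_iff_exists.mp hfin
  rw [← hα] at hf'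
  have hγ : α + j • lam = γ := by exact_mod_cast hf'
  obtain ⟨p, hp⟩ : α + (j / e) • e • lam ∈ μ.valueGroup htor :=
    add_mem ⟨_, hα.symm⟩ (nsmul_mem hmem _)
  obtain ⟨b, hb, hvb⟩ := hval p _ hp
  refine ⟨b * φ ^ (j % e), ?_, ?_⟩
  · have hb0 : b ≠ 0 := by
      rintro rfl
      rw [μ.val.map_zero] at hvb
      exact WithTop.coe_ne_top hvb.symm
    apply degree_lt_degree
    rw [natDegree_mul hb0 (hφ.pow _).ne_zero, hφ.natDegree_pow]
    have h1 := natDegree_lt_natDegree hb0 hb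
    have h2 : (j % e + 1) * φ.natDegree ≤ e * φ.natDegree :=
      Nat.mul_le_mul_right _ (Nat.mod_lt j he)
    rw [add_mul, one_mul] at h2
    omega
  · rw [ν.val.map_mul, ν.val.map_pow, h.val_self hφ hd, h.val_eq hφ hd hb, hvb,
      ← WithTop.coe_nsmul, ← WithTop.coe_add, add_assoc, ← mul_nsmul', ← add_nsmul, mul_comm,
      Nat.div_add_mod, hγ]

variable {K' : Type*} [Field K'] {v' : AddValuation K' (WithTop Q)} {i : K →+* K'} {g : K[X]}

/-- The properties of the data `(μ, φ, n)` which the irreducibility test preserves. -/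
structure TestInvariant (v' : AddValuation K' (WithTop Q)) (i : K →+* K') (g : K[X])
    (s : PolyVal v × K[X] × ℕ) : Prop where
  pos : 0 < s.2.2
  isMinimal : IsMinimal s.1.val s.2.1
  natDegree_pos : 0 < s.2.1.natDegree
  natDegree_eq : g.natDegree = s.2.2 * s.2.1.natDegree
  le_val : s.2.2 • s.1.val s.2.1 ≤ s.1.val g
  hasValues : HasValues s.1 s.2.1
  integral : 0 ≤ gauss v s.2.1
  exists_lift : ∃ (θ ρ : Q) (β : K'[X] → WithTop Q), s.1.val s.2.1 = θ ∧ 0 ≤ ρ ∧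
    s.2.1.natDegree • ρ ≤ θ ∧ IsLift v' i s.1 ρ β
  gauss_le : ∀ f, gauss v f ≤ s.1.val f

theorem isMinimal_X (hμ : ∀ f, μ.val f = gauss v f) : IsMinimal μ.val X := by
  refine ⟨monic_X, fun f => ?_⟩
  rw [modByMonic_X, μ.val_C, hμ, ← coeff_zero_eq_eval_zero]
  exact OMFactorization.gauss_le f 0

theorem gauss_X : gauss v (X : K[X]) = 0 := by
  apply le_antisymm
  · simpa using OMFactorization.gauss_le (v := v) X 1
  · refine le_gauss_iff.mpr fun n => ?_
    rw [coeff_X]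
    split_ifs <;> simp

theorem TestInvariant.init (hi : ∀ a, v' (i a) = v a)
    (himm : ∀ c : K', c ≠ 0 → ∃ a : K, v' c < v' (c - i a)) (hμ : ∀ f, μ.val f = gauss v f)
    (hdeg : 0 < g.natDegree) (hint : 0 ≤ gauss v g) :
    TestInvariant v' i g (μ, X, g.natDegree) where
  pos := hdeg
  isMinimal := isMinimal_X hμ
  natDegree_pos := by simp
  natDegree_eq := by simp
  le_val := by
    rw [hμ, hμ, gauss_X, smul_zero]
    exact hint
  hasValues f γ hf := by
    rw [hμ] at hf
    have hne : f.support.Nonempty := by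
      rw [nonempty_support_iff]
      rintro rfl
      rw [gauss_zero] at hf
      exact WithTop.coe_ne_top hf.symm
    obtain ⟨n, -, hn⟩ := Finset.exists_mem_eq_inf f.support hne fun i => v (f.coeff i)
    refine ⟨C (f.coeff n), ?_, ?_⟩
    · rw [degree_X]
      exact degree_C_le.trans_lt (by norm_num)
    · rw [μ.val_C, ← hn]
      exact hf
  integral := gauss_X.ge
  exists_lift := ⟨0, 0, gauss v', by simp [hμ, gauss_X], le_rfl, by simp,
    isLift_gauss hi himm hμ⟩
  gauss_le f := (hμ f).ge

variable [Module ℚ Q] [IsStrictOrderedModule ℚ Q]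

theorem TestInvariant.hasExpansion {n : ℕ} (h : TestInvariant v' i g (μ, φ, n)) (hg : g.Monic)
    {θ : Q} (hθ : μ.val φ = θ) : HasExpansion μ φ g n θ where
  monic := h.isMinimal.monic
  pos := h.natDegree_pos
  monic_right := hg
  natDegree_eq := h.natDegree_eq
  le_val j := by
    have h1 := h.le_val.trans (h.isMinimal.le_val_expCoeff g j)
    rwa [μ.val.map_mul, μ.val.map_pow, hθ] at h1

/-- The slope of a side of the Newton polygon is at least the value of the key polynomial. -/
theorem TestInvariant.le_of_hasSide {n : ℕ} (h : TestInvariant v' i g (μ, φ, n)) (hg : g.Monic)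
    (hside : HasSide (newtonPolygon μ φ g) lam) : μ.val φ ≤ lam := by
  obtain ⟨θ, -, -, hθ, -⟩ := h.exists_lift
  rw [hθ]
  exact_mod_cast (h.hasExpansion hg hθ).le_of_hasSide hside

/-- The lift of the augmentation of the current valuation with respect to a side. -/
theorem TestInvariant.exists_lift_augmentation {n : ℕ} (h : TestInvariant v' i g (μ, φ, n))
    (hi : ∀ a, v' (i a) = v a) (hlam : μ.val φ ≤ lam) (hν : IsAugmentation μ φ lam ν) :
    ∃ (ρ : Q) (β : K'[X] → WithTop Q), ρ = ((φ.natDegree : ℚ)⁻¹) • lam ∧ 0 ≤ ρ ∧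
      φ.natDegree • ρ = lam ∧ IsLift v' i ν ρ β := by
  obtain ⟨θ, ρ, β, hθ, hρ0, hρ, hβ⟩ := h.exists_lift
  dsimp only at hθ hρ hβ
  have hd : 0 < φ.natDegree := h.natDegree_pos
  have hd' : (φ.natDegree : ℚ) ≠ 0 := by exact_mod_cast hd.ne'
  have hsm : φ.natDegree • ((φ.natDegree : ℚ)⁻¹ • lam) = lam := by
    rw [← Nat.cast_smul_eq_nsmul ℚ, smul_smul, mul_inv_cancel₀ hd', one_smul]
  have hθlam : θ ≤ lam := by
    rw [hθ] at hlam
    exact_mod_cast hlam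
  have hρle : ρ ≤ (φ.natDegree : ℚ)⁻¹ • lam := by
    by_contra! hcon
    have := nsmul_right_strictMono hd.ne' hcon
    simp only [hsm] at this
    exact this.not_ge (hρ.trans hθlam)
  exact ⟨_, _, rfl, hρ0.trans hρle, hsm, hβ.augmentation hi h.isMinimal.monic hd h.integral hρ0
    hρle hsm hν (hν.val_le h.isMinimal hlam)⟩

theorem TestInvariant.step (hi : ∀ a, v' (i a) = v a)
    (htor : ∀ γ : Q, ∃ N : ℕ, 0 < N ∧ ∃ a : K, v a = ((N • γ : Q) : WithTop Q))
    (hg : g.Monic) (hint : 0 ≤ gauss v g) (hdvd : ∀ m : ℕ, m ∣ g.natDegree → v (m : K) = 0)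
    {μ₀ : PolyVal v} (hμ₀ : ∀ f, μ₀.val f = gauss v f)
    {s t : PolyVal v × K[X] × ℕ} (h : TestInvariant v' i g s) (hst : TestStep g s t) :
    TestInvariant v' i g t := by
  obtain ⟨μ, φ, n⟩ := s
  obtain ⟨ν, q, m⟩ := t
  obtain ⟨-, ⟨lam, hone, hν⟩, hres, happ⟩ := hst
  dsimp only at hone hν hres happ
  have hφ : φ.Monic := h.isMinimal.monic
  have hd : 0 < φ.natDegree := h.natDegree_pos
  have hn : 0 < n := h.pos
  have hdeg : g.natDegree = n * φ.natDegree := h.natDegree_eq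
  obtain ⟨θ, -, -, hθ, -⟩ := h.exists_lift
  have hexp := h.hasExpansion hg hθ
  obtain ⟨hside, haug, ha0⟩ := hexp.of_isOneSided hone
  have hlam : μ.val φ ≤ lam := h.le_of_hasSide hg hside
  have hmin := hν.isMinimal hφ hd
  have hνφ := hν.val_self hφ hd
  have hνg : ν.val g = ((n • lam : Q) : WithTop Q) := (hν g).trans haug
  have hone' : expCoeff φ g n = 1 := expCoeff_of_monic hφ hd hg hdeg
  have hmem0 : 0 ∈ ν.levelSet φ g := by
    rw [PolyVal.levelSet, Finset.mem_filter, pow_zero, mul_one,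
      hν.val_eq hφ hd (degree_expCoeff_lt hφ g 0), ha0, hνg]
    exact ⟨Finset.mem_range.mpr (Nat.succ_pos _), rfl⟩
  have hmemn : n ∈ ν.levelSet φ g := by
    rw [PolyVal.levelSet, Finset.mem_filter, hone', one_mul, ν.val.map_pow, hνφ, hνg]
    refine ⟨Finset.mem_range.mpr ?_, rfl⟩
    rw [hdeg]
    nlinarith
  have hmax : ∀ j ∈ ν.levelSet φ g, j ≤ n := fun j hj => by
    rw [PolyVal.levelSet, Finset.mem_filter] at hj
    by_contra! hcon
    have hz : expCoeff φ g j = 0 := expCoeff_eq_zero hφ (by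
      rw [hdeg]; exact Nat.mul_lt_mul_of_pos_right hcon hd)
    rw [hz, zero_mul, ν.val.map_zero, hνg] at hj
    exact WithTop.coe_ne_top hj.2.symm
  -- The constant coefficient `a_0` of the expansion has value `n λ`, so `n λ` is a value of `μ` and
  -- `e` divides `n`.
  obtain ⟨he, hemem, hedvd⟩ := hν.eRel_spec hφ hd h.hasValues htor hn ⟨_, ha0⟩
  obtain ⟨d, hd0, hnm⟩ := hres.exists_eq_mul hmem0 hmemn hmax hedvd (by rw [hone']; simp)
  set k := ν.eRel φ * d
  have hk0 : 0 < k := Nat.mul_pos he hd0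
  have hm0 : 0 < m := happ.1
  have hq : q.Monic := happ.2.1
  have hqdeg : q.natDegree = k * φ.natDegree := by
    have h1 := happ.2.2.1
    rw [hdeg, hnm, mul_assoc] at h1
    exact Nat.eq_of_mul_eq_mul_left hm0 h1
  have hvm : v (m : K) = 0 := hdvd m ⟨_, happ.2.2.1.symm⟩
  have hνq : ν.val q = k • ν.val φ := le_antisymm (hmin.val_le_of_monic hd hq hqdeg)
    (hmin.le_val_approxRoot hd (by rw [hνφ]; exact WithTop.coe_ne_top) hg hk0 happ hqdeg
      (by rw [hνφ, hνg, ← mul_nsmul', ← hnm, WithTop.coe_nsmul]) (by rw [ν.val_C, hvm]))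
  have hle := hν.val_le h.isMinimal hlam
  refine ⟨hm0, hmin.of_monic hd hq hqdeg hνq.ge, ?_, ?_, ?_, ?_, ?_, ?_, fun f => ?_⟩
  · dsimp only
    rw [hqdeg]
    positivity
  · exact happ.2.2.1.symm
  · dsimp only
    rw [hνq, hνφ, hνg, ← mul_nsmul', ← hnm, WithTop.coe_nsmul]
  · refine hν.hasValues hφ hd h.hasValues htor he hemem ?_
    rw [hqdeg]
    exact Nat.mul_le_mul_right _ (Nat.le_mul_of_pos_right _ hd0)
  -- Integrality of `q`: the bound for approximate roots, applied to the Gauss valuation with `x` as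
  -- minimal polynomial of value `0`.
  · have h1 := (isMinimal_X hμ₀).le_val_approxRoot (g := g) (m := m) (k := q.natDegree) (q := q)
      (by simp) (by rw [hμ₀, gauss_X]; exact WithTop.zero_ne_top) hg (by rw [hqdeg]; positivity)
      happ (by simp) (by rw [hμ₀ X, gauss_X, smul_zero, smul_zero, hμ₀]; exact hint)
      (by rw [μ₀.val_C, hvm])
    rwa [hμ₀, hμ₀, gauss_X, smul_zero] at h1
  · obtain ⟨ρ, β, -, hρ0, hρ, hβ⟩ := h.exists_lift_augmentation hi hlam hν
    -- The ratio of value to degree is the same for `q` as for `φ` under `ν`, so `ρ` is kept.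
    refine ⟨k • lam, ρ, β, by rw [WithTop.coe_nsmul, ← hνφ]; exact hνq, hρ0, ?_, hβ⟩
    dsimp only
    rw [hqdeg, mul_nsmul', hρ]
  · exact (h.gauss_le f).trans (hle f)

end Chain

/-! ### The divisible hull and the residue characteristic -/

section Hull

variable {K Γ : Type*} [Field K] [AddCommGroup Γ] [LinearOrder Γ] [IsOrderedAddMonoid Γ]

theorem hullVal_of_eq {v : AddValuation K (WithTop Γ)} {a : K} {γ : Γ} (h : v a = γ) :
    hullVal v a = ((γ : DivisibleHull Γ) : WithTop (DivisibleHull Γ)) := by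
  change (DivisibleHull.coeAddMonoidHom Γ).withTopMap (v a) = _
  rw [h]
  rfl

theorem hullVal_nonneg {v : AddValuation K (WithTop Γ)} {a : K} (h : 0 ≤ v a) :
    0 ≤ hullVal v a := by
  have := (DivisibleHull.coeOrderAddMonoidHom Γ).monotone'.withTop_map h
  exact (by simp : (0 : WithTop (DivisibleHull Γ)) = _).trans_le this

theorem exists_hullVal_eq_nsmul {v : AddValuation K (WithTop Γ)} (hv : ∀ γ : Γ, ∃ a : K, v a = γ)
    (γ : DivisibleHull Γ) :
    ∃ N : ℕ, 0 < N ∧ ∃ a : K, hullVal v a = ((N • γ : DivisibleHull Γ) : WithTop _) := by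
  induction γ using DivisibleHull.ind with
  | mk m s =>
    obtain ⟨a, ha⟩ := hv m
    refine ⟨s, s.pos, a, ?_⟩
    rw [hullVal_of_eq ha, DivisibleHull.nsmul_mk, WithTop.coe_inj, DivisibleHull.mk_eq_mk]
    exact ⟨1, by simp⟩

theorem val_natCast_eq_zero {Q : Type*} [AddCommGroup Q] [LinearOrder Q] [IsOrderedAddMonoid Q]
    (v : AddValuation K (WithTop Q)) {m : ℕ} (h : ¬ ringChar (baseResidueField v) ∣ m) :
    v (m : K) = 0 := by
  have h1 : (m : baseResidueField v) ≠ 0 := fun h0 => h ((ringChar.spec _ _).mp h0)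
  have h2 : IsUnit (m : valRing v) := by
    by_contra hu
    refine h1 ?_
    rw [← map_natCast (IsLocalRing.residue (valRing v)), IsLocalRing.residue_eq_zero_iff]
    exact hu
  have h3 := (Valuation.valuationSubring.integers
    (AddValuation.toValuation v)).isUnit_iff_valuation_eq_one.mp h2
  exact h3

end Hull

end

end OMFactorization

theorem mainTheorem8 {K L Γ : Type*} [Field K] [Field L] [Algebra K L] [IsAlgClosure K L]
    [AddCommGroup Γ] [LinearOrder Γ] [IsOrderedAddMonoid Γ]
    (v : AddValuation K (WithTop Γ)) (hv : ∀ γ : Γ, ∃ a : K, v a = γ)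
    (w : AddValuation L (WithTop (DivisibleHull Γ)))
    (hw : ∀ a : K, w (algebraMap K L a) = OMFactorization.hullVal v a)
    (g : Polynomial K) (hg : g.Monic) (hsf : Squarefree g)
    (hchar : ¬ ringChar (OMFactorization.baseResidueField (OMFactorization.hullVal v)) ∣
      g.natDegree)
    (hint : ∀ i : ℕ, 0 ≤ v (g.coeff i))
    (μ μl : OMFactorization.PolyVal (OMFactorization.hullVal v)) (φ : Polynomial K)
    (lam : DivisibleHull Γ)
    (hsplit : OMFactorization.IsSplittingPair g μ φ)
    (hlam : OMFactorization.IsRightEndSlope (OMFactorization.newtonPolygon μ φ g) lam)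
    (hμl : OMFactorization.IsAugmentation μ φ lam μl)
    (μh μlh : OMFactorization.PolyVal (OMFactorization.henselVal K w))
    (hμh : OMFactorization.IsCommonExtension w μ μh)
    (hμlh : OMFactorization.IsCommonExtension w μl μlh)
    (F : Polynomial (OMFactorization.Henselization K w)) :
    OMFactorization.gauss (OMFactorization.henselVal K w) F ≤ μh.val F ∧
      μh.val F ≤ μlh.val F ∧
      μlh.val F ≤ OMFactorization.gauss (OMFactorization.henselVal K w) F +
        ((((F.natDegree : ℚ) / (φ.natDegree : ℚ)) • lam : DivisibleHull Γ) :
          WithTop (DivisibleHull Γ)) := by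
  have hi : ∀ a, OMFactorization.henselVal K w (algebraMap K _ a) =
      OMFactorization.hullVal v a := hw
  have htor := OMFactorization.exists_hullVal_eq_nsmul hv
  have htorw : OMFactorization.TorsionOver K w := fun z hz => by
    obtain ⟨γ, hγ⟩ := WithTop.ne_top_iff_exists.mp (w.ne_top_iff.mpr hz)
    obtain ⟨N, hN, a, ha⟩ := htor γ
    exact ⟨N, hN, a, by rw [hw, ha, ← hγ, WithTop.coe_nsmul]⟩
  have himm := fun c (hc : c ≠ 0) =>
    OMFactorization.exists_approx_henselization (K := K) w htorw (c := c) hc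
  have hint' : 0 ≤ OMFactorization.gauss (OMFactorization.hullVal v) g :=
    OMFactorization.le_gauss_iff.mpr fun i => OMFactorization.hullVal_nonneg (hint i)
  -- Every characteristic, including `0`, divides `0`.
  have hdeg : 0 < g.natDegree := Nat.pos_of_ne_zero fun h => hchar (h ▸ dvd_zero _)
  obtain ⟨μ₀, n, hμ₀, hchain, -⟩ := hsplit
  have hinv : OMFactorization.TestInvariant (OMFactorization.henselVal K w)
      (algebraMap K (OMFactorization.Henselization K w)) g (μ, φ, n) := by
    generalize (μ, φ, n) = s at hchain
    induction hchain with
    | refl => exact OMFactorization.TestInvariant.init hi himm hμ₀ hdeg hint'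
    | tail _ hstep ih =>
      exact ih.step hi htor hg hint' (fun m hm => OMFactorization.val_natCast_eq_zero _
        fun h => hchar (h.trans hm)) hμ₀ hstep
  have hle : μ.val φ ≤ lam := hinv.le_of_hasSide hg hlam.1
  have hmono := hμl.val_le hinv.isMinimal hle
  obtain ⟨_, _, β, -, -, -, hβ⟩ := hinv.exists_lift
  obtain ⟨ρ, βl, hρ, -, -, hβl⟩ := hinv.exists_lift_augmentation hi hle hμl
  refine ⟨(OMFactorization.isLift_gauss hi himm hμ₀).le_val μ
    (fun f => (hμ₀ f).trans_le (hinv.gauss_le f)) μh hμh F, ?_, ?_⟩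
  · rw [hβ.eq_val μh hμh]
    exact hβ.le_val μl hmono μlh hμlh F
  · rw [hβl.eq_val μlh hμlh, div_eq_mul_inv, mul_smul, ← hρ, Nat.cast_smul_eq_nsmul]
    exact hβl.le_gauss_add F
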